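/- **Setting.** Let $M$ be a connected $C^\infty$-manifold without boundary of dimension $n\ge 2$. A *Lorentz–Finsler structure* is a function $L:TM\to\mathbb R$ that is $C^\infty$ on $TM\setminus\{0\}$, satisfies $L(cv)=c^2L(v)$ for all $v\in TM$ and $c>0$, and for which, for every $v\in TM\setminus\{0\}$, the matrix $g_{ij}(v)=\frac{\partial^2L}{\partial v^i\partial v^j}(v)$ is non-degenerate with signature $(-,+,\dots,+)$. Put $g_v(a,b)=\sum_{i,j} g_{ij}(v)a^ib^j$. A vector $v$ is *timelike* if $L(v)<0$; for $L(v)\le 0$ put $F(v)=\sqrt{-2L(v)}$. A *Finsler spacetime* is such a pair $(M,L)$ that is time-oriented by a smooth timelike vector field $X$; with $\Omega'_x\subset T_xM$ the set of timelike vectors, a timelike $v\in T_xM$ is *future-directed* if it lies in the same connected component of $\overline{\Omega'_x}\setminus\{0\}$ as $X(x)$, and $\Omega_x$ is the set of future-directed timelike vectors in $T_xM$. In local coordinates let $(g^{ij})=(g_{ij})^{-1}$, $$\gamma^i_{jk}=\tfrac12\sum_l g^{il}\Big(\frac{\partial g_{lk}}{\partial x^j}+\frac{\partial g_{jl}}{\partial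 x^k}-\frac{\partial g_{jk}}{\partial x^l}\Big),\quad G^i(v)=\sum_{j,k}\gamma^i_{jk}(v)v^jv^k,\quad N^i_j=\tfrac12\frac{\partial G^i}{\partial v^j},$$ $$\Gamma^i_{jk}=\gamma^i_{jk}-\tfrac12\sum_{l,m}g^{il}\Big(\frac{\partial g_{lk}}{\partial v^m}N^m_j+\frac{\partial g_{jl}}{\partial v^m}N^m_k-\frac{\partial g_{jk}}{\partial v^m}N^m_l\Big),$$ $$R^i_j(v)=\frac{\partial G^i}{\partial x^j}-\sum_k\Big\{\frac{\partial N^i_j}{\partial x^k}v^k-\frac{\partial N^i_j}{\partial v^k}G^k+N^i_kN^k_j\Big\},\qquad R_v(w)=\sum_{i,j}R^i_j(v)w^j\frac{\partial}{\partial x^i}.$$ $(M,L)$ is a *Berwald spacetime* if moreover $\Gamma^i_{jk}$ is constant on $T_xM\setminus\{0\}$ for every $x$. A *geodesic* is a $C^2$-curve $\eta$ with $\ddot\eta^i+\sum_{j,k}\Gamma^i_{jk}(\dot\eta)\dot\eta^j\dot\eta^k=0$ (constant curves included); $\exp_y(v)=\eta(1)$ for the geodesic $\eta:[0,1]\to M$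 with $\eta(0)=y$, $\dot\eta(0)=v$. *$\mathbf K\ge0$ in timelike directions* means that $$\mathbf K(v,w)=\frac{g_v(R_v(w),w)}{g_v(v,v)g_v(w,w)-g_v(v,w)^2}\ge 0$$ for all $x\in M$, $v\in\Omega_x$ and $w\in T_xM$ linearly independent of $v$. A *convex normal neighborhood* is a nonempty open set $U\subset M$ such that, for every $y\in U$, $\exp_y$ gives a $C^1$-diffeomorphism from an open star-shaped (about $0$) subset of $T_yM$ onto $U$. **Proposition 3.3 (Concave norm).** Let $(M,L)$ be a Berwald spacetime with $\mathbf K\ge0$ in timelike directions, let $U\subset M$ be a convex normal neighborhood, let $\varepsilon>0$, and let $\sigma:[0,1]\times(-\varepsilon,\varepsilon)\to U$ be a $C^2$ map such that $\sigma_s(t):=\sigma(t,s)$ is a geodesic for each $s\in(-\varepsilon,\varepsilon)$ and such that $V(t,s):=\partial_s\sigma(t,s)$ is future-directed timelike for all $(t,s)$. Then, for every $s\in(-\varepsilon,\varepsilon)$, the function $t\mapsto F(V(t,s))$ is concave on $[0,1]$. -/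

import Mathlib

open Set
open scoped Manifold ContDiff

noncomputable section

namespace FinslerSpacetime

/-- The coordinate space `ℝⁿ`. -/
abbrev Coord (n : ℕ) : Type := EuclideanSpace ℝ (Fin n)

section Coordinates

/-! ### Coordinate expressions

Here `f x v` and `ℓ x v` are functions of the position coordinates `x = (xⁱ)` and of the fibre
coordinates `v = (vⁱ)`; `ℓ` is the coordinate expression of the Lorentz–Finsler structure. -/

variable {n : ℕ}

/-- The partial derivative `∂f/∂xⁱ`. -/
def dpos (i : Fin n) (f : Coord n → Coord n → ℝ) (x v : Coord n) : ℝ :=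
  fderiv ℝ (fun y => f y v) x (EuclideanSpace.single i 1)

/-- The partial derivative `∂f/∂vⁱ`. -/
def dvel (i : Fin n) (f : Coord n → Coord n → ℝ) (x v : Coord n) : ℝ :=
  fderiv ℝ (fun u => f x u) v (EuclideanSpace.single i 1)

/-- The components `g_{ij}(v) = ∂²ℓ/∂vⁱ∂vʲ`. -/
def gComp (ℓ : Coord n → Coord n → ℝ) (i j : Fin n) (x v : Coord n) : ℝ :=
  dvel i (dvel j ℓ) x v

/-- The matrix `(g_{ij}(v))`. -/
def gMatrix (ℓ : Coord n → Coord n → ℝ) (x v : Coord n) : Matrix (Fin n) (Fin n) ℝ :=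
  Matrix.of fun i j => gComp ℓ i j x v

/-- The components `g^{ij}(v)` of the inverse matrix. -/
def gInv (ℓ : Coord n → Coord n → ℝ) (i j : Fin n) (x v : Coord n) : ℝ :=
  (gMatrix ℓ x v)⁻¹ i j

/-- The formal Christoffel symbols `γ^i_{jk}(v)`. -/
def formalChristoffel (ℓ : Coord n → Coord n → ℝ) (i j k : Fin n) (x v : Coord n) : ℝ :=
  (1 / 2 : ℝ) * ∑ l, gInv ℓ i l x v *
    (dpos j (gComp ℓ l k) x v + dpos k (gComp ℓ j l) x v - dpos l (gComp ℓ j k) x v)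

/-- The geodesic spray coefficients `G^i(v) = ∑ γ^i_{jk}(v) vʲ vᵏ` (in particular `G^i(0) = 0`). -/
def spray (ℓ : Coord n → Coord n → ℝ) (i : Fin n) (x v : Coord n) : ℝ :=
  ∑ j, ∑ k, formalChristoffel ℓ i j k x v * v j * v k

open Classical in
/-- The nonlinear connection `N^i_j(v) = ½ ∂G^i/∂vʲ(v)`, with `N^i_j(0) = 0`. -/
def nonlinearConn (ℓ : Coord n → Coord n → ℝ) (i j : Fin n) (x v : Coord n) : ℝ :=
  if v = 0 then 0 else (1 / 2 : ℝ) * dvel j (spray ℓ i) x v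

/-- The coefficients `Γ^i_{jk}(v)` of the Chern connection. -/
def chern (ℓ : Coord n → Coord n → ℝ) (i j k : Fin n) (x v : Coord n) : ℝ :=
  formalChristoffel ℓ i j k x v -
    (1 / 2 : ℝ) * ∑ l, ∑ m, gInv ℓ i l x v *
      (dvel m (gComp ℓ l k) x v * nonlinearConn ℓ m j x v
        + dvel m (gComp ℓ j l) x v * nonlinearConn ℓ m k x v
        - dvel m (gComp ℓ j k) x v * nonlinearConn ℓ m l x v)

/-- The components `R^i_j(v)` of the curvature tensor. -/
def curvComp (ℓ : Coord n → Coord n → ℝ) (i j : Fin n) (x v : Coord n) : ℝ :=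
  dpos j (spray ℓ i) x v -
    ∑ k, (dpos k (nonlinearConn ℓ i j) x v * v k
      - dvel k (nonlinearConn ℓ i j) x v * spray ℓ k x v
      + nonlinearConn ℓ i k x v * nonlinearConn ℓ k j x v)

/-- The bilinear form `g_v(a, b) = ∑ g_{ij}(v) aⁱ bʲ`. -/
def gForm (ℓ : Coord n → Coord n → ℝ) (x v a b : Coord n) : ℝ :=
  ∑ i, ∑ j, gComp ℓ i j x v * a i * b j

/-- The vector `R_v(w) = ∑ R^i_j(v) wʲ ∂/∂xⁱ`. -/
def curvOp (ℓ : Coord n → Coord n → ℝ) (x v w : Coord n) : Coord n :=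
  WithLp.toLp 2 fun i => ∑ j, curvComp ℓ i j x v * w j

/-- The quotient `g_v(R_v(w), w) / (g_v(v, v) g_v(w, w) - g_v(v, w)²)`. -/
def coordFlagCurvature (ℓ : Coord n → Coord n → ℝ) (x v w : Coord n) : ℝ :=
  gForm ℓ x v (curvOp ℓ x v w) w /
    (gForm ℓ x v v v * gForm ℓ x v w w - gForm ℓ x v v w ^ 2)

/-- `A` is a non-degenerate symmetric matrix of signature `(-, +, …, +)`: it is congruent to
`diag(-1, 1, …, 1)`. -/
def HasLorentzSignature (A : Matrix (Fin n) (Fin n) ℝ) : Prop :=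
  ∃ P : Matrix (Fin n) (Fin n) ℝ, IsUnit P.det ∧
    P.transpose * A * P = Matrix.diagonal fun i : Fin n => if (i : ℕ) = 0 then -1 else 1

end Coordinates

section Spacetimes

variable {n : ℕ} {M : Type*} [TopologicalSpace M] [ChartedSpace (Coord n) M]
  [IsManifold 𝓘(ℝ, Coord n) ∞ M]

/-- The coordinate expression `(y, v) ↦ L(∑ vⁱ ∂/∂xⁱ|_y)` of `L : TM → ℝ` in the chart `φ`. -/
def localRep (L : TangentBundle 𝓘(ℝ, Coord n) M → ℝ)
    (φ : OpenPartialHomeomorph M (Coord n)) (y v : Coord n) : ℝ :=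
  L ⟨φ.symm y, mfderiv 𝓘(ℝ, Coord n) 𝓘(ℝ, Coord n) φ.symm y v⟩

variable (M) in
/-- All smooth charts of `M`. -/
abbrev smoothCharts : Set (OpenPartialHomeomorph M (Coord n)) :=
  IsManifold.maximalAtlas 𝓘(ℝ, Coord n) ∞ M

/-- Lorentz–Finsler structures on `M`. -/
structure IsLorentzFinsler (L : TangentBundle 𝓘(ℝ, Coord n) M → ℝ) : Prop where
  smooth : ContMDiffOn 𝓘(ℝ, Coord n).tangent 𝓘(ℝ, ℝ) ∞ L {p | p.2 ≠ 0}
  homogeneous : ∀ (x : M) (v : TangentSpace 𝓘(ℝ, Coord n) x) (c : ℝ), 0 < c →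
    L ⟨x, c • v⟩ = c ^ 2 * L ⟨x, v⟩
  signature : ∀ φ ∈ smoothCharts (n := n) M, ∀ y ∈ φ.target, ∀ v : Coord n, v ≠ 0 →
    HasLorentzSignature (gMatrix (localRep L φ) y v)

/-- A Finsler spacetime: a Lorentz–Finsler manifold, time-oriented by the smooth timelike
vector field `X`. -/
structure IsFinslerSpacetime (L : TangentBundle 𝓘(ℝ, Coord n) M → ℝ)
    (X : ∀ x : M, TangentSpace 𝓘(ℝ, Coord n) x) : Prop extends IsLorentzFinsler L where
  smooth_orientation : ContMDiff 𝓘(ℝ, Coord n) 𝓘(ℝ, Coord n).tangent ∞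
    (fun x => (⟨x, X x⟩ : TangentBundle 𝓘(ℝ, Coord n) M))
  timelike_orientation : ∀ x, L ⟨x, X x⟩ < 0

/-- A Berwald spacetime: in every smooth chart, the coefficients of the Chern connection are
constant on every slit tangent space. -/
structure IsBerwaldSpacetime (L : TangentBundle 𝓘(ℝ, Coord n) M → ℝ)
    (X : ∀ x : M, TangentSpace 𝓘(ℝ, Coord n) x) : Prop extends IsFinslerSpacetime L X where
  chern_const : ∀ φ ∈ smoothCharts (n := n) M, ∀ y ∈ φ.target, ∀ v w : Coord n,
    v ≠ 0 → w ≠ 0 → ∀ i j k : Fin n,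
      chern (localRep L φ) i j k y v = chern (localRep L φ) i j k y w

/-- `p = (x, v)` is a future-directed timelike vector: `L(v) < 0`, and `v` lies in the same
connected component of `closure Ω'_x \ {0}` as `X x`, where `Ω'_x` is the set of timelike vectors
in `T_x M`. -/
def IsFutureTimelike (L : TangentBundle 𝓘(ℝ, Coord n) M → ℝ)
    (X : ∀ x : M, TangentSpace 𝓘(ℝ, Coord n) x) (p : TangentBundle 𝓘(ℝ, Coord n) M) : Prop :=
  L p < 0 ∧
    p.2 ∈ connectedComponentIn
      (closure {u : TangentSpace 𝓘(ℝ, Coord n) p.1 | L ⟨p.1, u⟩ < 0} \ {0}) (X p.1)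

/-- `F(v) = √(-2 L(v))`, for causal `v`. -/
def F (L : TangentBundle 𝓘(ℝ, Coord n) M → ℝ) (p : TangentBundle 𝓘(ℝ, Coord n) M) : ℝ :=
  Real.sqrt (-2 * L p)

/-- The flag curvature `K(v, w)`, for `v, w ∈ T_x M`. It does not depend on the coordinates;
it is computed here in the preferred chart at `x`. -/
def flagCurvature (L : TangentBundle 𝓘(ℝ, Coord n) M → ℝ) (x : M)
    (v w : TangentSpace 𝓘(ℝ, Coord n) x) : ℝ :=
  coordFlagCurvature (localRep L (chartAt (Coord n) x)) (chartAt (Coord n) x x)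
    (mfderiv 𝓘(ℝ, Coord n) 𝓘(ℝ, Coord n) (chartAt (Coord n) x) x v)
    (mfderiv 𝓘(ℝ, Coord n) 𝓘(ℝ, Coord n) (chartAt (Coord n) x) x w)

/-- `K ≥ 0` in timelike directions. -/
def NonnegTimelikeFlagCurvature (L : TangentBundle 𝓘(ℝ, Coord n) M → ℝ)
    (X : ∀ x : M, TangentSpace 𝓘(ℝ, Coord n) x) : Prop :=
  ∀ (x : M) (v w : TangentSpace 𝓘(ℝ, Coord n) x),
    IsFutureTimelike L X ⟨x, v⟩ → LinearIndependent ℝ ![v, w] → 0 ≤ flagCurvature L x v w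

/-- `η : [0, 1] → M` is a geodesic: in every smooth chart its coordinates `c` satisfy
`c̈ⁱ + ∑ Γ^i_{jk}(ċ) ċʲ ċᵏ = 0`. Constant curves are geodesics. -/
structure IsGeodesic (L : TangentBundle 𝓘(ℝ, Coord n) M → ℝ) (η : ℝ → M) : Prop where
  contMDiffOn : ContMDiffOn 𝓘(ℝ, ℝ) 𝓘(ℝ, Coord n) 2 η (Icc 0 1)
  equation : ∀ φ ∈ smoothCharts (n := n) M, ∀ t ∈ Icc (0 : ℝ) 1, η t ∈ φ.source →
    ∀ i : Fin n,
      (derivWithin (derivWithin (fun r => φ (η r)) (Icc 0 1)) (Icc 0 1) t) i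
        + ∑ j, ∑ k,
          chern (localRep L φ) i j k (φ (η t)) (derivWithin (fun r => φ (η r)) (Icc 0 1) t)
            * (derivWithin (fun r => φ (η r)) (Icc 0 1) t) j
            * (derivWithin (fun r => φ (η r)) (Icc 0 1) t) k = 0

/-- `exp_y(v)` is defined and equal to `z`: the geodesic with initial velocity `v ∈ T_y M` exists
on `[0, 1]` and is at `z` at time `1`. -/
def IsExp (L : TangentBundle 𝓘(ℝ, Coord n) M → ℝ) (y : M)
    (v : TangentSpace 𝓘(ℝ, Coord n) y) (z : M) : Prop :=
  ∃ η : ℝ → M, IsGeodesic L η ∧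
    (⟨η 0, mfderivWithin 𝓘(ℝ, ℝ) 𝓘(ℝ, Coord n) η (Icc 0 1) 0 (1 : ℝ)⟩ :
      TangentBundle 𝓘(ℝ, Coord n) M) = ⟨y, v⟩ ∧ η 1 = z

/-- `U` is a convex normal neighborhood: an open set such that, for every `y ∈ U`, the exponential
map `exp_y` is a `C¹`-diffeomorphism from an open star-shaped set in `T_y M` onto `U`. -/
def IsConvexNormalNhd (L : TangentBundle 𝓘(ℝ, Coord n) M → ℝ) (U : Set M) : Prop :=
  IsOpen U ∧ U.Nonempty ∧ ∀ y ∈ U, ∃ e : OpenPartialHomeomorph (Coord n) M,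
    StarConvex ℝ 0 e.source ∧ e.target = U ∧
    (∀ v ∈ e.source, IsExp L y v (e v)) ∧
    ContMDiffOn 𝓘(ℝ, Coord n) 𝓘(ℝ, Coord n) 1 e e.source ∧
    ContMDiffOn 𝓘(ℝ, Coord n) 𝓘(ℝ, Coord n) 1 e.symm U

/-- The variation field `V(t, s) = ∂_s σ(t, s)`, as an element of `TM` over `σ(t, s)`. -/
def variationField (σ : ℝ → ℝ → M) (t s : ℝ) : TangentBundle 𝓘(ℝ, Coord n) M :=
  ⟨σ t s, mfderiv 𝓘(ℝ, ℝ) 𝓘(ℝ, Coord n) (fun r => σ t r) s (1 : ℝ)⟩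

end Spacetimes

end FinslerSpacetime

end

/-! In the Berwald case the Chern coefficients depend on the position only, so they form a
torsion-free affine connection `B = chernForm`, and `L` is parallel for it: its derivative vanishes
on horizontal vectors `(a, -B(a, v))` (`jointDeriv_horizontal`). Differentiating this once more
shows that the curvature operators `R(a, b)` are infinitesimal symmetries of `L`
(`jointDeriv_affineCurv`), and polarising in the fibre gives their skewness `g_v(u, R(a, b)v) =
-g_v(v, R(a, b)u)` (`gForm_affineCurv_skew`).

Let `T` be the velocity of the geodesics, `V` the variation field, `Y` the covariant derivative of
`V` along them, and `q = L(V)`. Parallelism gives `q' = g_V(V, Y)`. The Jacobi equation `D_t Y =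
-R(V, T)T` and skewness give `q'' = g_V(Y, Y) - g_V(R_V(T), T)`. As `g_V(V, V) = 2q`, the function
`F = √(-2q)` satisfies `F³ F'' = 2q q'' - q'² = (g_V(V, V) g_V(Y, Y) - g_V(V, Y)²) - 2q g_V(R_V(T),
T)`. The bracket is nonpositive by the reverse Cauchy–Schwarz inequality. The same inequality makes
the denominator of the flag curvature negative, so `K ≥ 0` means `g_V(R_V(T), T) ≤ 0`
(`gForm_curvOp_nonpos`); since `q < 0`, the last term is nonpositive too. Hence `F'' ≤ 0` on the
open interval, and continuity up to the endpoints gives concavity.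

The computation is local and is made in a chart around each interior point. The Jacobi equation
involves a third derivative of a map that is only `C²`; it exists because the geodesic equation
expresses the second `t`-derivative through first-order data
(`hasDerivAt_partial_of_hasStrictFDerivAt`). -/

noncomputable section

namespace FinslerSpacetime

/-! ### Partial derivatives of functions on the slit tangent bundle, in coordinates -/

section CoordinateCalculus

variable {n : ℕ}

/-- `f` is smooth in the positions `x ∈ W` and the velocities `v ≠ 0`. -/
abbrev SmoothOffZero (W : Set (Coord n)) (f : Coord n → Coord n → ℝ) : Prop :=
  ContDiffOn ℝ ∞ (fun p : Coord n × Coord n => f p.1 p.2) (W ×ˢ {0}ᶜ)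

/-- The full derivative of `f x v` in the pair `(x, v)`. -/
abbrev jointDeriv (f : Coord n → Coord n → ℝ) (p : Coord n × Coord n) :
    Coord n × Coord n →L[ℝ] ℝ :=
  fderiv ℝ (fun p : Coord n × Coord n => f p.1 p.2) p

theorem isOpen_offZero {W : Set (Coord n)} (hW : IsOpen W) :
    IsOpen (W ×ˢ ({0}ᶜ : Set (Coord n))) :=
  hW.prod isOpen_compl_singleton

theorem SmoothOffZero.contDiffAt {W : Set (Coord n)} (hW : IsOpen W)
    {f : Coord n → Coord n → ℝ} (hf : SmoothOffZero W f) {x v : Coord n} (hx : x ∈ W)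
    (hv : v ≠ 0) : ContDiffAt ℝ ∞ (fun p : Coord n × Coord n => f p.1 p.2) (x, v) :=
  ContDiffOn.contDiffAt hf ((isOpen_offZero hW).mem_nhds ⟨hx, hv⟩)

theorem SmoothOffZero.hasFDerivAt {W : Set (Coord n)} (hW : IsOpen W)
    {f : Coord n → Coord n → ℝ} (hf : SmoothOffZero W f) {x v : Coord n} (hx : x ∈ W)
    (hv : v ≠ 0) :
    HasFDerivAt (fun p : Coord n × Coord n => f p.1 p.2) (jointDeriv f (x, v)) (x, v) :=
  ((hf.contDiffAt hW hx hv).differentiableAt (by simp)).hasFDerivAt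

theorem SmoothOffZero.hasFDerivAt_pos {W : Set (Coord n)} (hW : IsOpen W)
    {f : Coord n → Coord n → ℝ} (hf : SmoothOffZero W f) {x v : Coord n} (hx : x ∈ W)
    (hv : v ≠ 0) :
    HasFDerivAt (fun y => f y v) ((jointDeriv f (x, v)).comp (.inl ℝ _ _)) x :=
  HasFDerivAt.comp (g := fun p : Coord n × Coord n => f p.1 p.2) (f := fun y => (y, v)) x
    (hf.hasFDerivAt hW hx hv)
    (hasFDerivAt_prodMk_left x v)

theorem SmoothOffZero.hasFDerivAt_vel {W : Set (Coord n)} (hW : IsOpen W)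
    {f : Coord n → Coord n → ℝ} (hf : SmoothOffZero W f) {x v : Coord n} (hx : x ∈ W)
    (hv : v ≠ 0) :
    HasFDerivAt (fun u => f x u) ((jointDeriv f (x, v)).comp (.inr ℝ _ _)) v :=
  HasFDerivAt.comp (g := fun p : Coord n × Coord n => f p.1 p.2) v (hf.hasFDerivAt hW hx hv)
    (hasFDerivAt_prodMk_right x v)

theorem SmoothOffZero.dpos_eq {W : Set (Coord n)} (hW : IsOpen W)
    {f : Coord n → Coord n → ℝ} (hf : SmoothOffZero W f) {x v : Coord n} (hx : x ∈ W)
    (hv : v ≠ 0) (i : Fin n) :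
    dpos i f x v = jointDeriv f (x, v) (EuclideanSpace.single i 1, 0) := by
  simp [dpos, (hf.hasFDerivAt_pos hW hx hv).fderiv]

theorem SmoothOffZero.dvel_eq {W : Set (Coord n)} (hW : IsOpen W)
    {f : Coord n → Coord n → ℝ} (hf : SmoothOffZero W f) {x v : Coord n} (hx : x ∈ W)
    (hv : v ≠ 0) (i : Fin n) :
    dvel i f x v = jointDeriv f (x, v) (0, EuclideanSpace.single i 1) := by
  simp [dvel, (hf.hasFDerivAt_vel hW hx hv).fderiv]

theorem SmoothOffZero.contDiffOn_jointDeriv {W : Set (Coord n)} (hW : IsOpen W)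
    {f : Coord n → Coord n → ℝ} (hf : SmoothOffZero W f) :
    ContDiffOn ℝ ∞ (jointDeriv f) (W ×ˢ {0}ᶜ) :=
  ContDiffOn.fderiv_of_isOpen hf (isOpen_offZero hW) (by simp)

theorem SmoothOffZero.dpos {W : Set (Coord n)} (hW : IsOpen W)
    {f : Coord n → Coord n → ℝ} (hf : SmoothOffZero W f) (i : Fin n) :
    SmoothOffZero W (dpos i f) :=
  ((hf.contDiffOn_jointDeriv hW).clm_apply contDiffOn_const).congr
    fun _ hp => hf.dpos_eq hW hp.1 hp.2 i

theorem SmoothOffZero.dvel {W : Set (Coord n)} (hW : IsOpen W)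
    {f : Coord n → Coord n → ℝ} (hf : SmoothOffZero W f) (i : Fin n) :
    SmoothOffZero W (dvel i f) :=
  ((hf.contDiffOn_jointDeriv hW).clm_apply contDiffOn_const).congr
    fun _ hp => hf.dvel_eq hW hp.1 hp.2 i

theorem SmoothOffZero.gComp {W : Set (Coord n)} (hW : IsOpen W)
    {ℓ : Coord n → Coord n → ℝ} (hℓ : SmoothOffZero W ℓ) (i j : Fin n) :
    SmoothOffZero W (gComp ℓ i j) :=
  (hℓ.dvel hW j).dvel hW i

theorem SmoothOffZero.jointDeriv_jointDeriv {W : Set (Coord n)} (hW : IsOpen W)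
    {f : Coord n → Coord n → ℝ} (hf : SmoothOffZero W f) {x v : Coord n} (hx : x ∈ W)
    (hv : v ≠ 0) :
    HasFDerivAt (jointDeriv f) (fderiv ℝ (jointDeriv f) (x, v)) (x, v) :=
  (((hf.contDiffOn_jointDeriv hW).contDiffAt ((isOpen_offZero hW).mem_nhds
    (show (x, v) ∈ W ×ˢ ({0}ᶜ : Set (Coord n)) from ⟨hx, hv⟩))).differentiableAt
    (by simp)).hasFDerivAt

theorem SmoothOffZero.jointDeriv_symm {W : Set (Coord n)} (hW : IsOpen W)
    {f : Coord n → Coord n → ℝ} (hf : SmoothOffZero W f) {x v : Coord n} (hx : x ∈ W)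
    (hv : v ≠ 0) (a b : Coord n × Coord n) :
    fderiv ℝ (jointDeriv f) (x, v) a b = fderiv ℝ (jointDeriv f) (x, v) b a := by
  have h := (hf.contDiffAt hW hx hv).isSymmSndFDerivAt (by
    simpa using WithTop.coe_le_coe.2 (le_top : (2 : ℕ∞) ≤ ⊤))
  exact h a b

/-- Two functions which agree off the zero section have the same derivative there. -/
theorem dvel_congr {f g : Coord n → Coord n → ℝ} {x v : Coord n} (hv : v ≠ 0)
    (h : ∀ u, u ≠ 0 → f x u = g x u) (i : Fin n) : dvel i f x v = dvel i g x v := by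
  have : (fun u => f x u) =ᶠ[nhds v] fun u => g x u := by
    filter_upwards [isOpen_compl_singleton.mem_nhds (show v ∈ ({0}ᶜ : Set _) from hv)] with u hu
    exact h u hu
  simp only [dvel, this.fderiv_eq]

theorem SmoothOffZero.dvel_dvel {W : Set (Coord n)} (hW : IsOpen W)
    {f : Coord n → Coord n → ℝ} (hf : SmoothOffZero W f) {x v : Coord n} (hx : x ∈ W)
    (hv : v ≠ 0) (i j : Fin n) :
    FinslerSpacetime.dvel i (FinslerSpacetime.dvel j f) x v =
      fderiv ℝ (jointDeriv f) (x, v) (0, EuclideanSpace.single i 1)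
        (0, EuclideanSpace.single j 1) := by
  rw [dvel_congr (g := fun y u => jointDeriv f (y, u) (0, EuclideanSpace.single j 1)) hv
    (fun u hu => hf.dvel_eq hW hx hu j)]
  have h := ((hf.jointDeriv_jointDeriv hW hx hv).comp v
    (hasFDerivAt_prodMk_right x v)).clm_apply
      (hasFDerivAt_const ((0 : Coord n), EuclideanSpace.single j (1 : ℝ)) v)
  have h' := HasFDerivAt.fderiv h
  simp only [Function.comp_def] at h'
  rw [FinslerSpacetime.dvel, h']
  simp

theorem SmoothOffZero.dvel_comm {W : Set (Coord n)} (hW : IsOpen W)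
    {f : Coord n → Coord n → ℝ} (hf : SmoothOffZero W f) {x v : Coord n} (hx : x ∈ W)
    (hv : v ≠ 0) (i j : Fin n) :
    FinslerSpacetime.dvel i (FinslerSpacetime.dvel j f) x v =
      FinslerSpacetime.dvel j (FinslerSpacetime.dvel i f) x v := by
  rw [hf.dvel_dvel hW hx hv, hf.dvel_dvel hW hx hv, hf.jointDeriv_symm hW hx hv]

theorem coord_eq_sum (v : Coord n) : v = ∑ i, v i • EuclideanSpace.single i (1 : ℝ) := by
  ext k
  simp [Finset.sum_apply, Pi.single_apply]

theorem sum_inl (v : Coord n) :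
    ∑ i, v i • ((EuclideanSpace.single i (1 : ℝ), 0) : Coord n × Coord n) = (v, 0) := by
  conv_rhs => rw [coord_eq_sum v]
  ext k <;> simp [Prod.fst_sum, Prod.snd_sum]

theorem sum_inr (v : Coord n) :
    ∑ i, v i • ((0, EuclideanSpace.single i (1 : ℝ)) : Coord n × Coord n) = (0, v) := by
  conv_rhs => rw [coord_eq_sum v]
  ext k <;> simp [Prod.fst_sum, Prod.snd_sum]

theorem SmoothOffZero.sum_dvel {W : Set (Coord n)} (hW : IsOpen W)
    {f : Coord n → Coord n → ℝ} (hf : SmoothOffZero W f) {x v : Coord n} (hx : x ∈ W)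
    (hv : v ≠ 0) (a : Coord n) :
    ∑ i, FinslerSpacetime.dvel i f x v * a i = jointDeriv f (x, v) (0, a) := by
  rw [← sum_inr a, map_sum]
  exact Finset.sum_congr rfl fun i _ => by rw [hf.dvel_eq hW hx hv, map_smul, smul_eq_mul, mul_comm]

theorem SmoothOffZero.sum_dpos {W : Set (Coord n)} (hW : IsOpen W)
    {f : Coord n → Coord n → ℝ} (hf : SmoothOffZero W f) {x v : Coord n} (hx : x ∈ W)
    (hv : v ≠ 0) (a : Coord n) :
    ∑ i, FinslerSpacetime.dpos i f x v * a i = jointDeriv f (x, v) (a, 0) := by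
  rw [← sum_inl a, map_sum]
  exact Finset.sum_congr rfl fun i _ => by rw [hf.dpos_eq hW hx hv, map_smul, smul_eq_mul, mul_comm]

theorem SmoothOffZero.gForm_eq {W : Set (Coord n)} (hW : IsOpen W)
    {ℓ : Coord n → Coord n → ℝ} (hℓ : SmoothOffZero W ℓ) {x v : Coord n} (hx : x ∈ W)
    (hv : v ≠ 0) (a b : Coord n) :
    gForm ℓ x v a b = fderiv ℝ (jointDeriv ℓ) (x, v) (0, a) (0, b) := by
  rw [← sum_inr a, ← sum_inr b, map_sum (fderiv ℝ (jointDeriv ℓ) (x, v)), sum_apply]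
  refine Finset.sum_congr rfl fun i _ => ?_
  rw [map_sum]
  refine Finset.sum_congr rfl fun j _ => ?_
  rw [FinslerSpacetime.gComp, hℓ.dvel_dvel hW hx hv]
  simp only [map_smul, smul_apply, smul_eq_mul]
  ring

end CoordinateCalculus

/-! ### Euler relations and compatibility of the Chern connection with the metric -/

section BerwaldCoordinates

variable {n : ℕ} {W : Set (Coord n)} {ℓ : Coord n → Coord n → ℝ}

/-- A Lorentz–Finsler structure of Berwald type on an open subset of the coordinate space. -/
structure IsCoordBerwald (W : Set (Coord n)) (ℓ : Coord n → Coord n → ℝ) : Prop where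
  isOpen : IsOpen W
  smooth : SmoothOffZero W ℓ
  homogeneous : ∀ x ∈ W, ∀ (v : Coord n) (c : ℝ), 0 < c → ℓ x (c • v) = c ^ 2 * ℓ x v
  signature : ∀ x ∈ W, ∀ v : Coord n, v ≠ 0 → HasLorentzSignature (gMatrix ℓ x v)
  chern_const : ∀ x ∈ W, ∀ v w : Coord n, v ≠ 0 → w ≠ 0 → ∀ i j k : Fin n,
    chern ℓ i j k x v = chern ℓ i j k x w

theorem HasLorentzSignature.isUnit_det {A : Matrix (Fin n) (Fin n) ℝ}
    (hA : HasLorentzSignature A) : IsUnit A.det := by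
  obtain ⟨P, -, h⟩ := hA
  have h2 := congrArg Matrix.det h
  rw [Matrix.det_mul, Matrix.det_mul, Matrix.det_diagonal] at h2
  have h3 : (∏ i : Fin n, if (i : ℕ) = 0 then (-1 : ℝ) else 1) ≠ 0 :=
    Finset.prod_ne_zero_iff.2 fun i _ => by split_ifs <;> norm_num
  rw [isUnit_iff_ne_zero]
  rintro h0
  rw [h0] at h2
  exact h3 (by rw [← h2]; ring)

namespace IsCoordBerwald

theorem gComp_symm (h : IsCoordBerwald W ℓ) {x v : Coord n} (hx : x ∈ W) (hv : v ≠ 0)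
    (i j : Fin n) : gComp ℓ i j x v = gComp ℓ j i x v :=
  h.smooth.dvel_comm h.isOpen hx hv i j

/-- Euler's relation: differentiate `ℓ(cv) = c² ℓ(v)` in `c` at `c = 1`. -/
theorem jointDeriv_self (h : IsCoordBerwald W ℓ) {x v : Coord n} (hx : x ∈ W) (hv : v ≠ 0) :
    jointDeriv ℓ (x, v) (0, v) = 2 * ℓ x v := by
  have h1 := h.smooth.hasFDerivAt_vel h.isOpen hx hv
  have h2 : HasDerivAt (fun c : ℝ => c • v) ((1 : ℝ) • v) 1 := (hasDerivAt_id (1 : ℝ)).smul_const v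
  rw [← one_smul ℝ v] at h1
  have h3 := HasFDerivAt.comp_hasDerivAt (1 : ℝ) h1 h2
  have h4 : HasDerivAt (fun c : ℝ => c ^ 2 * ℓ x v) (2 * ℓ x v) 1 := by
    simpa using (hasDerivAt_pow 2 (1 : ℝ)).mul_const (ℓ x v)
  have h5 : ((fun u => ℓ x u) ∘ fun c : ℝ => c • v) =ᶠ[nhds 1] fun c : ℝ => c ^ 2 * ℓ x v := by
    filter_upwards [lt_mem_nhds (zero_lt_one : (0 : ℝ) < 1)] with c hc
    exact h.homogeneous x hx v c hc
  have h6 := h3.unique (h4.congr_of_eventuallyEq h5)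
  simpa using h6

theorem sum_dvel_self (h : IsCoordBerwald W ℓ) {x v : Coord n} (hx : x ∈ W) (hv : v ≠ 0) :
    ∑ i, dvel i ℓ x v * v i = 2 * ℓ x v := by
  rw [h.smooth.sum_dvel h.isOpen hx hv, h.jointDeriv_self hx hv]

theorem hasFDerivAt_apply (k : Fin n) (v : Coord n) :
    HasFDerivAt (fun u : Coord n => u k) (EuclideanSpace.proj k : Coord n →L[ℝ] ℝ) v :=
  (EuclideanSpace.proj k : Coord n →L[ℝ] ℝ).hasFDerivAt

/-- The product rule for contractions with the velocity. -/
theorem dvel_sum_mul {f : Fin n → Coord n → Coord n → ℝ} (hW : IsOpen W)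
    (hf : ∀ k, SmoothOffZero W (f k)) {x v : Coord n} (hx : x ∈ W) (hv : v ≠ 0) (m : Fin n) :
    dvel m (fun y u => ∑ k, f k y u * u k) x v = ∑ k, dvel m (f k) x v * v k + f m x v := by
  have h1 : HasFDerivAt (fun u : Coord n => ∑ k, f k x u * u k)
      (∑ k, (f k x v • (EuclideanSpace.proj k : Coord n →L[ℝ] ℝ) +
        v k • (jointDeriv (f k) (x, v)).comp (.inr ℝ _ _))) v :=
    HasFDerivAt.fun_sum fun k _ =>
      ((hf k).hasFDerivAt_vel hW hx hv).mul (hasFDerivAt_apply k v)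
  rw [dvel, h1.fderiv, sum_apply]
  simp only [add_apply, smul_apply, ContinuousLinearMap.comp_apply, smul_eq_mul,
    Finset.sum_add_distrib]
  rw [add_comm]
  congr 1
  · refine Finset.sum_congr rfl fun k _ => ?_
    rw [(hf k).dvel_eq hW hx hv, mul_comm]
    simp
  · simp

/-- A fibre derivative of Euler's relation; the product rule leaves one copy of `∂_l ℓ` to subtract
from `2 ∂_l ℓ`. -/
theorem sum_gComp_self (h : IsCoordBerwald W ℓ) {x v : Coord n} (hx : x ∈ W) (hv : v ≠ 0)
    (l : Fin n) : ∑ k, gComp ℓ l k x v * v k = dvel l ℓ x v := by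
  have h1 := dvel_sum_mul h.isOpen (fun k => h.smooth.dvel h.isOpen k) hx hv l
  have h2 : dvel l (fun y u => 2 * ℓ y u) x v = 2 * dvel l ℓ x v := by
    have := (h.smooth.hasFDerivAt_vel h.isOpen hx hv).const_mul 2
    rw [dvel, this.fderiv, h.smooth.dvel_eq h.isOpen hx hv]
    simp
  rw [dvel_congr (g := fun y u => 2 * ℓ y u) hv (fun u hu => h.sum_dvel_self hx hu), h2] at h1
  simp only [gComp]
  linarith

theorem gForm_self_left (h : IsCoordBerwald W ℓ) {x v : Coord n} (hx : x ∈ W) (hv : v ≠ 0)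
    (b : Coord n) : gForm ℓ x v v b = jointDeriv ℓ (x, v) (0, b) := by
  rw [← h.smooth.sum_dvel h.isOpen hx hv, gForm, Finset.sum_comm]
  refine Finset.sum_congr rfl fun j _ => ?_
  rw [← h.sum_gComp_self hx hv, Finset.sum_mul]
  exact Finset.sum_congr rfl fun i _ => by rw [h.gComp_symm hx hv]

/-- One more fibre derivative of Euler's relation: the Cartan tensor is annihilated by `v`. This
removes every `N`-term that is contracted with `v` below. -/
theorem sum_dvel_gComp_self (h : IsCoordBerwald W ℓ) {x v : Coord n} (hx : x ∈ W) (hv : v ≠ 0)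
    (m l : Fin n) : ∑ k, dvel m (gComp ℓ l k) x v * v k = 0 := by
  have h1 := dvel_sum_mul h.isOpen (fun k => h.smooth.gComp h.isOpen l k) hx hv m
  rw [dvel_congr (g := dvel l ℓ) hv (fun u hu => h.sum_gComp_self hx hu l)] at h1
  have h2 := h.gComp_symm hx hv m l
  simp only [gComp] at h1 h2 ⊢
  linarith

theorem dvel_gComp_symm (h : IsCoordBerwald W ℓ) {x v : Coord n} (hx : x ∈ W) (hv : v ≠ 0)
    (m i j : Fin n) : dvel m (gComp ℓ i j) x v = dvel m (gComp ℓ j i) x v :=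
  dvel_congr hv (fun _ hu => h.gComp_symm hx hu i j) m

theorem dpos_congr (hW : IsOpen W) {f g : Coord n → Coord n → ℝ} {x v : Coord n} (hx : x ∈ W)
    (hfg : ∀ y ∈ W, f y v = g y v) (i : Fin n) : dpos i f x v = dpos i g x v := by
  have : (fun y => f y v) =ᶠ[nhds x] fun y => g y v := by
    filter_upwards [hW.mem_nhds hx] with y hy
    exact hfg y hy
  simp only [dpos, this.fderiv_eq]

theorem dpos_gComp_symm (h : IsCoordBerwald W ℓ) {x v : Coord n} (hx : x ∈ W) (hv : v ≠ 0)
    (m i j : Fin n) : dpos m (gComp ℓ i j) x v = dpos m (gComp ℓ j i) x v :=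
  dpos_congr h.isOpen hx (fun _ hy => h.gComp_symm hy hv i j) m

end IsCoordBerwald

/-- The horizontal derivative `δ_j f = ∂f/∂xʲ - N^m_j ∂f/∂v^m`. -/
def horDeriv (ℓ : Coord n → Coord n → ℝ) (j : Fin n) (f : Coord n → Coord n → ℝ)
    (x v : Coord n) : ℝ :=
  dpos j f x v - ∑ m, dvel m f x v * nonlinearConn ℓ m j x v

/-- The Chern coefficients are the Levi-Civita expression with `∂_j` replaced by `δ_j`, so the usual
Koszul manipulations apply to them. -/
theorem chern_eq_sum_horDeriv (ℓ : Coord n → Coord n → ℝ) (i j k : Fin n) (x v : Coord n) :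
    chern ℓ i j k x v = ∑ l, gInv ℓ i l x v * ((1 / 2 : ℝ) *
      (horDeriv ℓ j (gComp ℓ l k) x v + horDeriv ℓ k (gComp ℓ j l) x v
        - horDeriv ℓ l (gComp ℓ j k) x v)) := by
  simp only [chern, formalChristoffel, horDeriv]
  rw [Finset.mul_sum, Finset.mul_sum, ← Finset.sum_sub_distrib]
  refine Finset.sum_congr rfl fun l _ => ?_
  rw [← Finset.mul_sum, Finset.sum_sub_distrib, Finset.sum_add_distrib]
  ring

namespace IsCoordBerwald

theorem sum_gComp_gInv (h : IsCoordBerwald W ℓ) {x v : Coord n} (hx : x ∈ W) (hv : v ≠ 0)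
    (a l : Fin n) : ∑ i, gComp ℓ a i x v * gInv ℓ i l x v = if a = l then 1 else 0 := by
  have h1 := Matrix.mul_nonsing_inv _ (h.signature x hx v hv).isUnit_det
  have h2 := congrFun (congrFun h1 a) l
  rwa [Matrix.mul_apply, Matrix.one_apply] at h2

theorem sum_gComp_chern (h : IsCoordBerwald W ℓ) {x v : Coord n} (hx : x ∈ W) (hv : v ≠ 0)
    (a j k : Fin n) : ∑ i, gComp ℓ a i x v * chern ℓ i j k x v = (1 / 2 : ℝ) *
      (horDeriv ℓ j (gComp ℓ a k) x v + horDeriv ℓ k (gComp ℓ j a) x v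
        - horDeriv ℓ a (gComp ℓ j k) x v) := by
  simp only [chern_eq_sum_horDeriv, Finset.mul_sum (s := Finset.univ)]
  rw [Finset.sum_comm]
  simp only [← mul_assoc, ← Finset.sum_mul, h.sum_gComp_gInv hx hv]
  simp

theorem horDeriv_gComp_symm (h : IsCoordBerwald W ℓ) {x v : Coord n} (hx : x ∈ W) (hv : v ≠ 0)
    (j a b : Fin n) : horDeriv ℓ j (gComp ℓ a b) x v = horDeriv ℓ j (gComp ℓ b a) x v := by
  simp only [horDeriv, h.dpos_gComp_symm hx hv j a b, h.dvel_gComp_symm hx hv _ a b]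

/-- Add the two lowered Koszul expressions: by symmetry of `g` all terms cancel except two equal
halves of `δ_j g_{ab}`. -/
theorem horDeriv_gComp (h : IsCoordBerwald W ℓ) {x v : Coord n} (hx : x ∈ W) (hv : v ≠ 0)
    (j a b : Fin n) : horDeriv ℓ j (gComp ℓ a b) x v =
      ∑ l, gComp ℓ a l x v * chern ℓ l j b x v + ∑ l, gComp ℓ b l x v * chern ℓ l j a x v := by
  rw [h.sum_gComp_chern hx hv, h.sum_gComp_chern hx hv, h.horDeriv_gComp_symm hx hv b j a,
    h.horDeriv_gComp_symm hx hv a j b, h.horDeriv_gComp_symm hx hv j b a]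
  ring

theorem chern_symm (h : IsCoordBerwald W ℓ) {x v : Coord n} (hx : x ∈ W) (hv : v ≠ 0)
    (i j k : Fin n) : chern ℓ i j k x v = chern ℓ i k j x v := by
  rw [chern_eq_sum_horDeriv, chern_eq_sum_horDeriv]
  refine Finset.sum_congr rfl fun l _ => ?_
  rw [h.horDeriv_gComp_symm hx hv j l k, h.horDeriv_gComp_symm hx hv k l j,
    h.horDeriv_gComp_symm hx hv l j k]
  ring

/-- The coefficients `Γ` and `γ` differ by products of the Cartan tensor with `N`. In each of the
three products some index contracted with `v` falls on the Cartan tensor, so the correction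
vanishes. -/
theorem sum_chern_self (h : IsCoordBerwald W ℓ) {x v : Coord n} (hx : x ∈ W) (hv : v ≠ 0)
    (i : Fin n) : ∑ j, ∑ k, chern ℓ i j k x v * v j * v k = spray ℓ i x v := by
  have e1 := fun m l => h.sum_dvel_gComp_self hx hv m l
  have e2 : ∀ m l, ∑ k, dvel m (gComp ℓ k l) x v * v k = 0 := fun m l => by
    rw [← e1 m l]
    exact Finset.sum_congr rfl fun k _ => by rw [h.dvel_gComp_symm hx hv]
  have key : ∀ l m : Fin n, ∑ j, ∑ k, (dvel m (gComp ℓ l k) x v * nonlinearConn ℓ m j x v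
        + dvel m (gComp ℓ j l) x v * nonlinearConn ℓ m k x v
        - dvel m (gComp ℓ j k) x v * nonlinearConn ℓ m l x v) * v j * v k = 0 := by
    intro l m
    have a1 : ∑ j, ∑ k, dvel m (gComp ℓ l k) x v * nonlinearConn ℓ m j x v * v j * v k = 0 := by
      refine Finset.sum_eq_zero fun j _ => ?_
      calc _ = ∑ k, (nonlinearConn ℓ m j x v * v j) * (dvel m (gComp ℓ l k) x v * v k) :=
            Finset.sum_congr rfl fun k _ => by ring
        _ = 0 := by rw [← Finset.mul_sum, e1, mul_zero]
    have a2 : ∑ j, ∑ k, dvel m (gComp ℓ j l) x v * nonlinearConn ℓ m k x v * v j * v k = 0 := by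
      rw [Finset.sum_comm]
      refine Finset.sum_eq_zero fun k _ => ?_
      calc _ = ∑ j, (nonlinearConn ℓ m k x v * v k) * (dvel m (gComp ℓ j l) x v * v j) :=
            Finset.sum_congr rfl fun k _ => by ring
        _ = 0 := by rw [← Finset.mul_sum, e2, mul_zero]
    have a3 : ∑ j, ∑ k, dvel m (gComp ℓ j k) x v * nonlinearConn ℓ m l x v * v j * v k = 0 := by
      refine Finset.sum_eq_zero fun j _ => ?_
      calc _ = ∑ k, (nonlinearConn ℓ m l x v * v j) * (dvel m (gComp ℓ j k) x v * v k) :=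
            Finset.sum_congr rfl fun k _ => by ring
        _ = 0 := by rw [← Finset.mul_sum, e1, mul_zero]
    simp only [sub_mul, add_mul, Finset.sum_add_distrib, Finset.sum_sub_distrib, a1, a2, a3]
    norm_num
  have key2 : ∑ j, ∑ k, (∑ l, ∑ m, gInv ℓ i l x v *
      (dvel m (gComp ℓ l k) x v * nonlinearConn ℓ m j x v
        + dvel m (gComp ℓ j l) x v * nonlinearConn ℓ m k x v
        - dvel m (gComp ℓ j k) x v * nonlinearConn ℓ m l x v)) * v j * v k = 0 := by
    calc _ = ∑ l, ∑ m, gInv ℓ i l x v * ∑ j, ∑ k,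
        (dvel m (gComp ℓ l k) x v * nonlinearConn ℓ m j x v
        + dvel m (gComp ℓ j l) x v * nonlinearConn ℓ m k x v
        - dvel m (gComp ℓ j k) x v * nonlinearConn ℓ m l x v) * v j * v k := by
          simp only [Finset.sum_mul, Finset.mul_sum]
          rw [Finset.sum_congr rfl fun j _ => Finset.sum_comm, Finset.sum_comm]
          refine Finset.sum_congr rfl fun l _ => ?_
          rw [Finset.sum_congr rfl fun j _ => Finset.sum_comm, Finset.sum_comm]
          refine Finset.sum_congr rfl fun m _ => Finset.sum_congr rfl fun j _ =>
            Finset.sum_congr rfl fun k _ => by ring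
      _ = 0 := by simp only [key, mul_zero, Finset.sum_const_zero]
  have : ∀ j k : Fin n, chern ℓ i j k x v * v j * v k =
      formalChristoffel ℓ i j k x v * v j * v k - (1 / 2 : ℝ) * ((∑ l, ∑ m, gInv ℓ i l x v *
      (dvel m (gComp ℓ l k) x v * nonlinearConn ℓ m j x v
        + dvel m (gComp ℓ j l) x v * nonlinearConn ℓ m k x v
        - dvel m (gComp ℓ j k) x v * nonlinearConn ℓ m l x v)) * v j * v k) := fun j k => by
    rw [chern]; ring
  rw [spray, ← sub_eq_zero, ← Finset.sum_sub_distrib]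
  rw [← neg_eq_zero, ← mul_eq_zero_iff_left (show (2 : ℝ) ≠ 0 by norm_num), ← key2,
    ← Finset.sum_neg_distrib, Finset.mul_sum]
  refine Finset.sum_congr rfl fun j _ => ?_
  rw [← Finset.sum_sub_distrib, ← Finset.sum_neg_distrib, Finset.mul_sum]
  refine Finset.sum_congr rfl fun k _ => ?_
  rw [this]
  ring

/-- The metric is parallel: its horizontal derivatives vanish. -/
theorem dpos_eq (h : IsCoordBerwald W ℓ) {x v : Coord n} (hx : x ∈ W) (hv : v ≠ 0)
    (j : Fin n) : dpos j ℓ x v = ∑ l, dvel l ℓ x v * ∑ k, chern ℓ l j k x v * v k := by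
  -- Differentiate `2ℓ = ∑ g_{ab} vᵃ vᵇ` in the position at fixed `v`. The derivatives of `g` are
  -- then expressed by `horDeriv_gComp`; the `N`-terms vanish (`h3`) and the two `Γ`-terms coincide
  -- (`h4`, `h5`).
  have h1 : 2 * dpos j ℓ x v = ∑ a, ∑ b, dpos j (gComp ℓ a b) x v * v b * v a := by
    have e : ∀ y ∈ W, 2 * ℓ y v = ∑ a, ∑ b, gComp ℓ a b y v * v b * v a := fun y hy => by
      rw [← h.sum_dvel_self hy hv]
      exact Finset.sum_congr rfl fun a _ => by rw [← h.sum_gComp_self hy hv, Finset.sum_mul]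
    have e1 := (h.smooth.hasFDerivAt_pos h.isOpen hx hv).const_mul 2
    have e2 : HasFDerivAt (fun y => ∑ a, ∑ b, gComp ℓ a b y v * v b * v a)
        (∑ a, ∑ b, v a • v b • (jointDeriv (gComp ℓ a b) (x, v)).comp (.inl ℝ _ _)) x :=
      HasFDerivAt.fun_sum fun a _ => HasFDerivAt.fun_sum fun b _ =>
        (((h.smooth.gComp h.isOpen a b).hasFDerivAt_pos h.isOpen hx hv).mul_const _).mul_const _
    have e3 := e1.unique (e2.congr_of_eventuallyEq (by
      filter_upwards [h.isOpen.mem_nhds hx] with y hy using e y hy))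
    have e4 := congrArg (fun A => A (EuclideanSpace.single j (1 : ℝ))) e3
    simp only [smul_apply, sum_apply, ContinuousLinearMap.comp_apply, smul_eq_mul,
      ContinuousLinearMap.inl_apply] at e4
    rw [h.smooth.dpos_eq h.isOpen hx hv, e4]
    refine Finset.sum_congr rfl fun a _ => Finset.sum_congr rfl fun b _ => ?_
    rw [(h.smooth.gComp h.isOpen a b).dpos_eq h.isOpen hx hv]
    ring
  have h2 : ∀ a b, dpos j (gComp ℓ a b) x v =
      ∑ m, dvel m (gComp ℓ a b) x v * nonlinearConn ℓ m j x v +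
      ∑ l, gComp ℓ a l x v * chern ℓ l j b x v + ∑ l, gComp ℓ b l x v * chern ℓ l j a x v := by
    intro a b
    have := h.horDeriv_gComp hx hv j a b
    rw [horDeriv] at this
    linarith
  have h3 : ∑ a, ∑ b, (∑ m, dvel m (gComp ℓ a b) x v * nonlinearConn ℓ m j x v) * v b * v a
      = 0 := by
    refine Finset.sum_eq_zero fun a _ => ?_
    rw [← Finset.sum_mul]
    simp only [Finset.sum_mul]
    rw [Finset.sum_comm]
    refine Finset.sum_eq_zero fun m _ => ?_
    calc _ = ∑ b, (nonlinearConn ℓ m j x v * v a) * (dvel m (gComp ℓ a b) x v * v b) :=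
            Finset.sum_congr rfl fun k _ => by ring
        _ = 0 := by rw [← Finset.mul_sum, h.sum_dvel_gComp_self hx hv, mul_zero]
  have h4 : ∑ a, ∑ b, (∑ l, gComp ℓ b l x v * chern ℓ l j a x v) * v b * v a =
      ∑ l, dvel l ℓ x v * ∑ k, chern ℓ l j k x v * v k := by
    simp only [Finset.sum_mul, Finset.mul_sum, ← h.sum_gComp_self hx hv]
    rw [Finset.sum_congr rfl fun j _ => Finset.sum_comm, Finset.sum_comm]
    refine Finset.sum_congr rfl fun l _ => Finset.sum_congr rfl fun a _ =>
      Finset.sum_congr rfl fun b _ => ?_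
    rw [h.gComp_symm hx hv b l]
    ring
  have h5 : ∑ a, ∑ b, (∑ l, gComp ℓ a l x v * chern ℓ l j b x v) * v b * v a =
      ∑ l, dvel l ℓ x v * ∑ k, chern ℓ l j k x v * v k := by
    rw [← h4, Finset.sum_comm]
    exact Finset.sum_congr rfl fun a _ => Finset.sum_congr rfl fun b _ => by ring
  simp only [h2, add_mul, Finset.sum_add_distrib, h3, h4, h5] at h1
  linarith

end IsCoordBerwald

end BerwaldCoordinates

/-! ### The Berwald connection as a smooth affine connection -/

section BerwaldConnection

variable {n : ℕ} {W : Set (Coord n)} {ℓ : Coord n → Coord n → ℝ}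

theorem contDiffOn_smul_vector {E F : Type*} [NormedAddCommGroup E] [NormedSpace ℝ E]
    [NormedAddCommGroup F] [NormedSpace ℝ F] {s : Set E} {k : WithTop ℕ∞} {f : E → ℝ}
    (hf : ContDiffOn ℝ k f s) (a : F) : ContDiffOn ℝ k (fun x => f x • a) s :=
  hf.smul contDiffOn_const

/-- The bilinear map `(a, b) ↦ c f(a) g(b) e`. -/
def rankOneBilin {E : Type*} [NormedAddCommGroup E] [NormedSpace ℝ E] (f g : E →L[ℝ] ℝ) (e : E)
    (c : ℝ) : E →L[ℝ] E →L[ℝ] E :=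
  c • f.smulRight (g.smulRight e)

theorem contDiffOn_rankOneBilin {E : Type*} [NormedAddCommGroup E] [NormedSpace ℝ E]
    (f g : E →L[ℝ] ℝ) (e : E) {s : Set E} {k : WithTop ℕ∞} {c : E → ℝ} (hc : ContDiffOn ℝ k c s) :
    ContDiffOn ℝ k (fun x => rankOneBilin f g e (c x)) s :=
  contDiffOn_smul_vector hc _

theorem contDiffOn_sum_rankOneBilin {E ι : Type*} [Fintype ι] [NormedAddCommGroup E]
    [NormedSpace ℝ E] (f : ι → E →L[ℝ] ℝ) (e : ι → E) {s : Set E} {m : WithTop ℕ∞}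
    {c : ι → ι → ι → E → ℝ} (hc : ∀ i j k, ContDiffOn ℝ m (c i j k) s) :
    ContDiffOn ℝ m (fun x => ∑ i, ∑ j, ∑ k, rankOneBilin (f j) (f k) (e i) (c i j k x)) s :=
  ContDiffOn.sum fun i _ => ContDiffOn.sum fun j _ => ContDiffOn.sum fun k _ =>
    contDiffOn_rankOneBilin _ _ _ (hc i j k)

theorem rankOneBilin_apply {E : Type*} [NormedAddCommGroup E] [NormedSpace ℝ E]
    (f g : E →L[ℝ] ℝ) (e : E) (c : ℝ) (a b : E) :
    rankOneBilin f g e c a b = (c * f a * g b) • e := by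
  simp [rankOneBilin, smul_smul, mul_assoc]

/-- Used to differentiate the horizontal lift `(a, -B(a, v))` in position and velocity together;
only the values of the derivative matter, hence the existential form. -/
theorem HasFDerivAt.bilin_apply_prod {E : Type*} [NormedAddCommGroup E] [NormedSpace ℝ E]
    {B : E → E →L[ℝ] E →L[ℝ] E} {B' : E →L[ℝ] E →L[ℝ] E →L[ℝ] E} {x : E}
    (hB : HasFDerivAt B B' x) (a v : E) :
    ∃ D : E × E →L[ℝ] E, HasFDerivAt (fun p : E × E => B p.1 a p.2) D (x, v) ∧
      ∀ c d, D (c, d) = B' c a v + B x a d := by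
  have h1 : HasFDerivAt (fun p : E × E => B p.1 a) ((B'.flip a).comp (.fst ℝ _ _)) (x, v) := by
    have h0 : HasFDerivAt (fun y => B y a) (B'.flip a) x := by
      simpa using hB.clm_apply (hasFDerivAt_const a x)
    exact HasFDerivAt.comp (x, v) (show HasFDerivAt (fun y => B y a) (B'.flip a) (x, v).1 from h0)
      hasFDerivAt_fst
  refine ⟨_, h1.clm_apply
    (hasFDerivAt_snd (𝕜 := ℝ) (E := E) (F := E) (p := (x, v))), fun c d => ?_⟩
  simp [add_comm]

theorem contDiffOn_det {E : Type*} [NormedAddCommGroup E] [NormedSpace ℝ E] {s : Set E}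
    {k : WithTop ℕ∞} {A : E → Matrix (Fin n) (Fin n) ℝ}
    (hA : ∀ i j, ContDiffOn ℝ k (fun p => A p i j) s) : ContDiffOn ℝ k (fun p => (A p).det) s := by
  simp only [Matrix.det_apply']
  exact ContDiffOn.sum fun τ _ => contDiffOn_const.mul (contDiffOn_prod fun i _ => hA _ _)

namespace IsCoordBerwald

/-- Cramer's rule: the adjugate is polynomial in the entries and the determinant does not vanish. -/
theorem smooth_gInv (h : IsCoordBerwald W ℓ) (i j : Fin n) : SmoothOffZero W (gInv ℓ i j) := by
  have hg : ∀ i j, ContDiffOn ℝ ∞ (fun p : Coord n × Coord n => gMatrix ℓ p.1 p.2 i j)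
      (W ×ˢ {0}ᶜ) := fun i j => h.smooth.gComp h.isOpen i j
  have h1 := contDiffOn_det hg
  have h2 : ContDiffOn ℝ ∞ (fun p : Coord n × Coord n => (gMatrix ℓ p.1 p.2).adjugate i j)
      (W ×ˢ {0}ᶜ) := by
    simp only [Matrix.adjugate_apply]
    refine contDiffOn_det fun a b => ?_
    simp only [Matrix.updateRow_apply]
    split_ifs
    · exact contDiffOn_const
    · exact hg a b
  refine ((h1.inv fun p hp => ?_).mul h2).congr fun p hp => ?_
  · exact (h.signature p.1 hp.1 p.2 hp.2).isUnit_det.ne_zero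
  · simp [gInv, Matrix.inv_def]

theorem smooth_formalChristoffel (h : IsCoordBerwald W ℓ) (i j k : Fin n) :
    SmoothOffZero W (formalChristoffel ℓ i j k) := by
  have hg := fun i j k => (h.smooth.gComp h.isOpen i j).dpos h.isOpen k
  exact contDiffOn_const.mul (ContDiffOn.sum fun l _ => (h.smooth_gInv i l).mul
    (((hg l k j).add (hg j l k)).sub (hg j k l)))

theorem smooth_spray (h : IsCoordBerwald W ℓ) (i : Fin n) : SmoothOffZero W (spray ℓ i) := by
  have hp : ∀ k : Fin n, ContDiffOn ℝ ∞ (fun p : Coord n × Coord n => p.2 k) (W ×ˢ {0}ᶜ) :=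
    fun k => ((EuclideanSpace.proj k : Coord n →L[ℝ] ℝ).contDiff.comp contDiff_snd).contDiffOn
  exact ContDiffOn.sum fun j _ => ContDiffOn.sum fun k _ =>
    ((h.smooth_formalChristoffel i j k).mul (hp j)).mul (hp k)

theorem smooth_nonlinearConn (h : IsCoordBerwald W ℓ) (i j : Fin n) :
    SmoothOffZero W (nonlinearConn ℓ i j) := by
  have h1 : ContDiffOn ℝ ∞ (fun p : Coord n × Coord n => (1 / 2 : ℝ) * dvel j (spray ℓ i) p.1 p.2)
      (W ×ˢ {0}ᶜ) := contDiffOn_const.mul ((h.smooth_spray i).dvel h.isOpen j)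
  exact h1.congr fun p hp => if_neg hp.2

theorem smooth_chern (h : IsCoordBerwald W ℓ) (i j k : Fin n) :
    SmoothOffZero W (chern ℓ i j k) := by
  have hg := fun i j k => (h.smooth.gComp h.isOpen i j).dvel h.isOpen k
  have hN := h.smooth_nonlinearConn
  exact (h.smooth_formalChristoffel i j k).sub (contDiffOn_const.mul
    (ContDiffOn.sum fun l _ => ContDiffOn.sum fun m _ => (h.smooth_gInv i l).mul
      ((((hg l k m).mul (hN m j)).add ((hg j l m).mul (hN m k))).sub ((hg j k m).mul (hN m l)))))

end IsCoordBerwald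

/-- The Chern connection as a bilinear map `(a, b) ↦ ∑ Γ^i_{jk} aʲ bᵏ ∂/∂xⁱ`, with the
coefficients taken at the reference vector `v₀`. -/
def chernForm (ℓ : Coord n → Coord n → ℝ) (v₀ x : Coord n) : Coord n →L[ℝ] Coord n →L[ℝ] Coord n :=
  ∑ i, ∑ j, ∑ k, rankOneBilin (EuclideanSpace.proj j) (EuclideanSpace.proj k)
    (EuclideanSpace.single i 1) (chern ℓ i j k x v₀)

theorem chernForm_apply (v₀ x a b : Coord n) (i : Fin n) :
    chernForm ℓ v₀ x a b i = ∑ j, ∑ k, chern ℓ i j k x v₀ * a j * b k := by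
  simp only [chernForm, sum_apply, rankOneBilin_apply,
    WithLp.ofLp_sum, WithLp.ofLp_smul, Finset.sum_apply, Pi.smul_apply, PiLp.proj_apply,
    smul_eq_mul, PiLp.single_apply]
  rw [Finset.sum_eq_single i]
  · simp [mul_assoc]
  · intro b _ hb
    simp [hb.symm]
  · simp

namespace IsCoordBerwald

variable {v₀ : Coord n}

theorem contDiffOn_chernForm (h : IsCoordBerwald W ℓ) (hv₀ : v₀ ≠ 0) :
    ContDiffOn ℝ ∞ (chernForm ℓ v₀) W := by
  have h1 : ∀ i j k, ContDiffOn ℝ ∞ (fun x => chern ℓ i j k x v₀) W := fun i j k =>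
    ContDiffOn.comp (g := fun p : Coord n × Coord n => chern ℓ i j k p.1 p.2)
      (f := fun x => (x, v₀)) (t := W ×ˢ {0}ᶜ) (h.smooth_chern i j k)
      (contDiff_prodMk_left v₀).contDiffOn fun x hx => ⟨hx, hv₀⟩
  exact contDiffOn_sum_rankOneBilin _ _ h1

theorem hasFDerivAt_chernForm (h : IsCoordBerwald W ℓ) (hv₀ : v₀ ≠ 0) {x : Coord n}
    (hx : x ∈ W) : HasFDerivAt (chernForm ℓ v₀) (fderiv ℝ (chernForm ℓ v₀) x) x :=
  (((h.contDiffOn_chernForm hv₀).contDiffAt (h.isOpen.mem_nhds hx)).differentiableAt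
    (by simp)).hasFDerivAt

theorem chernForm_symm (h : IsCoordBerwald W ℓ) (hv₀ : v₀ ≠ 0) {x : Coord n} (hx : x ∈ W)
    (a b : Coord n) : chernForm ℓ v₀ x a b = chernForm ℓ v₀ x b a := by
  ext i
  rw [chernForm_apply, chernForm_apply, Finset.sum_comm]
  refine Finset.sum_congr rfl fun j _ => Finset.sum_congr rfl fun k _ => ?_
  rw [h.chern_symm hx hv₀]
  ring

theorem fderiv_chernForm_symm (h : IsCoordBerwald W ℓ) (hv₀ : v₀ ≠ 0) {x : Coord n} (hx : x ∈ W)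
    (c a b : Coord n) :
    fderiv ℝ (chernForm ℓ v₀) x c a b = fderiv ℝ (chernForm ℓ v₀) x c b a := by
  have h1 := fun a b : Coord n => ((h.hasFDerivAt_chernForm hv₀ hx).clm_apply
    (hasFDerivAt_const a x)).clm_apply (hasFDerivAt_const b x)
  have h2 := (h1 a b).unique ((h1 b a).congr_of_eventuallyEq (by
    filter_upwards [h.isOpen.mem_nhds hx] with y hy using h.chernForm_symm hv₀ hy a b))
  simpa using congrArg (fun A => A c) h2

/-- The Chern connection, evaluated at any nonzero vector. -/
theorem sum_chern_eq (h : IsCoordBerwald W ℓ) (hv₀ : v₀ ≠ 0) {x v : Coord n} (hx : x ∈ W)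
    (hv : v ≠ 0) (a b : Coord n) (i : Fin n) :
    ∑ j, ∑ k, chern ℓ i j k x v * a j * b k = chernForm ℓ v₀ x a b i := by
  rw [chernForm_apply]
  exact Finset.sum_congr rfl fun j _ => Finset.sum_congr rfl fun k _ => by
    rw [h.chern_const x hx v v₀ hv hv₀]

/-- The zero vector is included because the velocity of a geodesic may vanish; there both sides are
zero, whatever `chern` is at `0`. -/
theorem sum_chern_self_eq (h : IsCoordBerwald W ℓ) (hv₀ : v₀ ≠ 0) {x : Coord n} (hx : x ∈ W)
    (v : Coord n) (i : Fin n) :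
    ∑ j, ∑ k, chern ℓ i j k x v * v j * v k = chernForm ℓ v₀ x v v i := by
  rcases eq_or_ne v 0 with rfl | hv
  · simp
  · exact h.sum_chern_eq hv₀ hx hv v v i

theorem spray_eq (h : IsCoordBerwald W ℓ) (hv₀ : v₀ ≠ 0) {x v : Coord n} (hx : x ∈ W)
    (hv : v ≠ 0) (i : Fin n) : spray ℓ i x v = chernForm ℓ v₀ x v v i := by
  rw [← h.sum_chern_self hx hv, h.sum_chern_eq hv₀ hx hv]

/-- The spray is the quadratic form of a symmetric bilinear map, so the factor `½` cancels the `2`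
of its derivative. -/
theorem nonlinearConn_eq (h : IsCoordBerwald W ℓ) (hv₀ : v₀ ≠ 0) {x v : Coord n} (hx : x ∈ W)
    (hv : v ≠ 0) (i j : Fin n) :
    nonlinearConn ℓ i j x v = chernForm ℓ v₀ x (EuclideanSpace.single j 1) v i := by
  have h1 : HasFDerivAt (fun u => chernForm ℓ v₀ x u u i) _ v :=
    (EuclideanSpace.proj i : Coord n →L[ℝ] ℝ).hasFDerivAt.comp v
      (((chernForm ℓ v₀ x).hasFDerivAt (x := v)).clm_apply (hasFDerivAt_id v))
  rw [nonlinearConn, if_neg hv,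
    dvel_congr (g := fun y u => chernForm ℓ v₀ y u u i) hv (fun u hu => h.spray_eq hv₀ hx hu i),
    dvel, h1.fderiv]
  simp [h.chernForm_symm hv₀ hx v]
  ring

theorem dpos_spray (h : IsCoordBerwald W ℓ) (hv₀ : v₀ ≠ 0) {x v : Coord n} (hx : x ∈ W)
    (hv : v ≠ 0) (i j : Fin n) : dpos j (spray ℓ i) x v =
      fderiv ℝ (chernForm ℓ v₀) x (EuclideanSpace.single j 1) v v i := by
  have h1 : HasFDerivAt (fun y => chernForm ℓ v₀ y v v i) _ x :=
    (EuclideanSpace.proj i : Coord n →L[ℝ] ℝ).hasFDerivAt.comp x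
      (((h.hasFDerivAt_chernForm hv₀ hx).clm_apply (hasFDerivAt_const v x)).clm_apply
        (hasFDerivAt_const v x))
  rw [dpos_congr (g := fun y u => chernForm ℓ v₀ y u u i) h.isOpen hx
    (fun y hy => h.spray_eq hv₀ hy hv i), dpos, h1.fderiv]
  simp

theorem dpos_nonlinearConn (h : IsCoordBerwald W ℓ) (hv₀ : v₀ ≠ 0) {x v : Coord n} (hx : x ∈ W)
    (hv : v ≠ 0) (i j k : Fin n) : dpos k (nonlinearConn ℓ i j) x v =
      fderiv ℝ (chernForm ℓ v₀) x (EuclideanSpace.single k 1) (EuclideanSpace.single j 1) v i := by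
  have h1 : HasFDerivAt (fun y => chernForm ℓ v₀ y (EuclideanSpace.single j 1) v i) _ x :=
    (EuclideanSpace.proj i : Coord n →L[ℝ] ℝ).hasFDerivAt.comp x
      (((h.hasFDerivAt_chernForm hv₀ hx).clm_apply (hasFDerivAt_const _ x)).clm_apply
        (hasFDerivAt_const v x))
  rw [dpos_congr (g := fun y u => chernForm ℓ v₀ y (EuclideanSpace.single j 1) u i) h.isOpen hx
    (fun y hy => h.nonlinearConn_eq hv₀ hy hv i j), dpos, h1.fderiv]
  simp

theorem dvel_nonlinearConn (h : IsCoordBerwald W ℓ) (hv₀ : v₀ ≠ 0) {x v : Coord n} (hx : x ∈ W)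
    (hv : v ≠ 0) (i j k : Fin n) : dvel k (nonlinearConn ℓ i j) x v =
      chernForm ℓ v₀ x (EuclideanSpace.single j 1) (EuclideanSpace.single k 1) i := by
  have h1 : HasFDerivAt (fun u => chernForm ℓ v₀ x (EuclideanSpace.single j 1) u i) _ v :=
    (EuclideanSpace.proj i : Coord n →L[ℝ] ℝ).hasFDerivAt.comp v
      ((chernForm ℓ v₀ x (EuclideanSpace.single j 1)).hasFDerivAt (x := v))
  rw [dvel_congr (g := fun y u => chernForm ℓ v₀ y (EuclideanSpace.single j 1) u i) hv
    (fun u hu => h.nonlinearConn_eq hv₀ hx hu i j), dvel, h1.fderiv]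
  simp

end IsCoordBerwald

/-! ### Curvature of the Berwald connection as an infinitesimal symmetry of `L` -/

/-- The curvature tensor `R(a, b)c` of the affine connection with coefficients `B`. -/
def affineCurv (B : Coord n → Coord n →L[ℝ] Coord n →L[ℝ] Coord n) (x a b c : Coord n) : Coord n :=
  fderiv ℝ B x a b c - fderiv ℝ B x b a c + B x a (B x b c) - B x b (B x a c)

theorem clm_coord_apply (A : Coord n →L[ℝ] Coord n) (a : Coord n) (i : Fin n) :
    A a i = ∑ k, A (EuclideanSpace.single k 1) i * a k := by
  conv_lhs => rw [coord_eq_sum a]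
  simp [map_sum, mul_comm]

namespace IsCoordBerwald

variable {v₀ : Coord n}

/-- With the spray quadratic and `N` linear in `v`, the four terms of `R^i_j` match the four terms
of `R(e_j, v)v` one by one. -/
theorem curvComp_eq (h : IsCoordBerwald W ℓ) (hv₀ : v₀ ≠ 0) {x v : Coord n} (hx : x ∈ W)
    (hv : v ≠ 0) (i j : Fin n) : curvComp ℓ i j x v =
      affineCurv (chernForm ℓ v₀) x (EuclideanSpace.single j 1) v v i := by
  have e1 : ∑ k, dpos k (nonlinearConn ℓ i j) x v * v k =
      fderiv ℝ (chernForm ℓ v₀) x v (EuclideanSpace.single j 1) v i := by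
    simp only [h.dpos_nonlinearConn hv₀ hx hv]
    exact (clm_coord_apply (((fderiv ℝ (chernForm ℓ v₀) x).flip
      (EuclideanSpace.single j 1)).flip v) v i).symm
  have e2 : ∑ k, dvel k (nonlinearConn ℓ i j) x v * spray ℓ k x v =
      chernForm ℓ v₀ x (EuclideanSpace.single j 1) (chernForm ℓ v₀ x v v) i := by
    simp only [h.dvel_nonlinearConn hv₀ hx hv, h.spray_eq hv₀ hx hv]
    exact (clm_coord_apply (chernForm ℓ v₀ x (EuclideanSpace.single j 1)) _ i).symm
  have e3 : ∑ k, nonlinearConn ℓ i k x v * nonlinearConn ℓ k j x v =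
      chernForm ℓ v₀ x v (chernForm ℓ v₀ x (EuclideanSpace.single j 1) v) i := by
    simp only [h.nonlinearConn_eq hv₀ hx hv]
    rw [h.chernForm_symm hv₀ hx v]
    exact (clm_coord_apply ((chernForm ℓ v₀ x).flip v) _ i).symm
  rw [curvComp, Finset.sum_add_distrib, Finset.sum_sub_distrib, e1, e2, e3,
    h.dpos_spray hv₀ hx hv]
  simp only [affineCurv, PiLp.add_apply, PiLp.sub_apply]
  ring

theorem curvOp_eq (h : IsCoordBerwald W ℓ) (hv₀ : v₀ ≠ 0) {x v : Coord n} (hx : x ∈ W)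
    (hv : v ≠ 0) (w : Coord n) :
    curvOp ℓ x v w = affineCurv (chernForm ℓ v₀) x w v v := by
  set B := chernForm ℓ v₀
  have key : ∀ a, affineCurv B x a v v = ((((fderiv ℝ B x).flip v).flip v) -
    ((fderiv ℝ B x v).flip v) + (B x).flip (B x v v) - (B x v).comp ((B x).flip v)) a := by
    intro a
    simp [affineCurv]
  ext i
  rw [key, clm_coord_apply]
  simp only [← key, curvOp]
  exact Finset.sum_congr rfl fun j _ => by rw [h.curvComp_eq hv₀ hx hv]

/-- `L` is parallel: its derivative vanishes on horizontal vectors. -/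
theorem jointDeriv_horizontal (h : IsCoordBerwald W ℓ) (hv₀ : v₀ ≠ 0) {x v : Coord n}
    (hx : x ∈ W) (hv : v ≠ 0) (a : Coord n) :
    jointDeriv ℓ (x, v) (a, -chernForm ℓ v₀ x a v) = 0 := by
  have e : jointDeriv ℓ (x, v) (a, 0) = jointDeriv ℓ (x, v) (0, chernForm ℓ v₀ x a v) := by
    rw [← h.smooth.sum_dpos h.isOpen hx hv, ← h.smooth.sum_dvel h.isOpen hx hv]
    simp only [h.dpos_eq hx hv, ← h.sum_chern_eq hv₀ hx hv, Finset.sum_mul, Finset.mul_sum]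
    rw [Finset.sum_comm]
    exact Finset.sum_congr rfl fun i _ => Finset.sum_congr rfl fun j _ =>
      Finset.sum_congr rfl fun k _ => by ring
  have : (a, -chernForm ℓ v₀ x a v) = (a, 0) - ((0, chernForm ℓ v₀ x a v) : Coord n × Coord n) := by
    simp
  rw [this, map_sub, e, sub_self]

theorem jointDeriv_pos (h : IsCoordBerwald W ℓ) (hv₀ : v₀ ≠ 0) {x v : Coord n}
    (hx : x ∈ W) (hv : v ≠ 0) (a b : Coord n) :
    jointDeriv ℓ (x, v) (a, b) = jointDeriv ℓ (x, v) (0, b + chernForm ℓ v₀ x a v) := by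
  have : (a, b) = (a, -chernForm ℓ v₀ x a v) +
      ((0, b + chernForm ℓ v₀ x a v) : Coord n × Coord n) := by simp
  rw [this, map_add, h.jointDeriv_horizontal hv₀ hx hv, zero_add]

/-- The derivative of `jointDeriv_horizontal`. -/
theorem fderiv_jointDeriv_horizontal (h : IsCoordBerwald W ℓ) (hv₀ : v₀ ≠ 0) {x v : Coord n}
    (hx : x ∈ W) (hv : v ≠ 0) (a c d : Coord n) :
    fderiv ℝ (jointDeriv ℓ) (x, v) (c, d) (a, -chernForm ℓ v₀ x a v) =
      jointDeriv ℓ (x, v) (0, fderiv ℝ (chernForm ℓ v₀) x c a v + chernForm ℓ v₀ x a d) := by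
  have h1 := h.smooth.jointDeriv_jointDeriv h.isOpen hx hv
  obtain ⟨D, h2, hD⟩ := HasFDerivAt.bilin_apply_prod (h.hasFDerivAt_chernForm hv₀ hx) a v
  have h4 := h1.clm_apply ((hasFDerivAt_const a (x, v)).prodMk h2.neg)
  have h5 : (fun p : Coord n × Coord n => jointDeriv ℓ p (a, -chernForm ℓ v₀ p.1 a p.2))
      =ᶠ[nhds (x, v)] fun _ => 0 := by
    filter_upwards [(isOpen_offZero h.isOpen).mem_nhds
      (show (x, v) ∈ W ×ˢ ({0}ᶜ : Set (Coord n)) from ⟨hx, hv⟩)] with p hp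
    exact h.jointDeriv_horizontal hv₀ hp.1 hp.2 a
  have h6 := congrArg (fun A => A (c, d))
    (h4.unique ((hasFDerivAt_const (0 : ℝ) (x, v)).congr_of_eventuallyEq h5))
  simp only [add_apply, ContinuousLinearMap.comp_apply, ContinuousLinearMap.prod_apply,
    ContinuousLinearMap.flip_apply, neg_apply, hD, zero_apply, Pi.neg_apply] at h6
  have : ((0, fderiv ℝ (chernForm ℓ v₀) x c a v + chernForm ℓ v₀ x a d) : Coord n × Coord n) =
    -(0, -(fderiv ℝ (chernForm ℓ v₀) x c a v + chernForm ℓ v₀ x a d)) := by simp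
  rw [this, map_neg]
  linarith

/-- The holonomy algebra preserves `L`. -/
theorem jointDeriv_affineCurv (h : IsCoordBerwald W ℓ) (hv₀ : v₀ ≠ 0) {x v : Coord n}
    (hx : x ∈ W) (hv : v ≠ 0) (a b : Coord n) :
    jointDeriv ℓ (x, v) (0, affineCurv (chernForm ℓ v₀) x a b v) = 0 := by
  -- The Hessian of `ℓ` is evaluated on the horizontal lifts of `a` and `b` in both orders. Its
  -- symmetry equates two vertical derivatives, whose difference is the bracket of the lifts, that
  -- is, the curvature.
  have h1 := h.fderiv_jointDeriv_horizontal hv₀ hx hv a b (-chernForm ℓ v₀ x b v)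
  have h2 := h.fderiv_jointDeriv_horizontal hv₀ hx hv b a (-chernForm ℓ v₀ x a v)
  rw [h.smooth.jointDeriv_symm h.isOpen hx hv, h2] at h1
  rw [← sub_eq_zero, ← map_sub] at h1
  rw [← h1]
  congr 1
  simp only [affineCurv, Prod.mk_sub_mk, map_neg, sub_zero]
  congr 1
  abel

/-- The fibre derivative of `jointDeriv_affineCurv` in the direction `u`. As `dℓ_v(w) = g_v(v, w)`,
this is skewness of the curvature with one argument equal to the base vector `v`, the only case
needed. -/
theorem gForm_affineCurv_skew (h : IsCoordBerwald W ℓ) (hv₀ : v₀ ≠ 0) {x v : Coord n}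
    (hx : x ∈ W) (hv : v ≠ 0) (a b u : Coord n) :
    fderiv ℝ (jointDeriv ℓ) (x, v) (0, u) (0, affineCurv (chernForm ℓ v₀) x a b v) =
      - jointDeriv ℓ (x, v) (0, affineCurv (chernForm ℓ v₀) x a b u) := by
  set B := chernForm ℓ v₀
  obtain ⟨R, hR⟩ : ∃ R : Coord n →L[ℝ] Coord n, ∀ c, affineCurv B x a b c = R c :=
    ⟨fderiv ℝ B x a b - fderiv ℝ B x b a + (B x a).comp (B x b) - (B x b).comp (B x a),
      fun c => by simp [affineCurv]⟩
  have h1 := (h.smooth.jointDeriv_jointDeriv h.isOpen hx hv).comp v (hasFDerivAt_prodMk_right x v)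
  have h2 := h1.clm_apply ((hasFDerivAt_const (0 : Coord n) v).prodMk R.hasFDerivAt)
  have h3 : (fun u : Coord n => (jointDeriv ℓ ∘ Prod.mk x) u (0, R u)) =ᶠ[nhds v] fun _ => 0 := by
    filter_upwards [isOpen_compl_singleton.mem_nhds (show v ∈ ({0}ᶜ : Set _) from hv)] with u hu
    rw [← hR]
    exact h.jointDeriv_affineCurv hv₀ hx hu a b
  have h4 := congrArg (fun A => A u)
    (h2.unique ((hasFDerivAt_const (0 : ℝ) v).congr_of_eventuallyEq h3))
  simp at h4
  rw [hR, hR]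
  linarith

end IsCoordBerwald

end BerwaldConnection

/-! ### The reverse Cauchy–Schwarz inequality -/

section ReverseCauchySchwarz

variable {n : ℕ}

/-- The reverse Cauchy–Schwarz inequality in Minkowski space. -/
theorem minkowski_reverse_cauchySchwarz (v w : Fin n → ℝ)
    (hv : ∑ i : Fin n, (if (i : ℕ) = 0 then (-1 : ℝ) else 1) * v i * v i < 0) :
    (∑ i : Fin n, (if (i : ℕ) = 0 then (-1 : ℝ) else 1) * v i * v i) *
      (∑ i : Fin n, (if (i : ℕ) = 0 then (-1 : ℝ) else 1) * w i * w i) -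
      (∑ i : Fin n, (if (i : ℕ) = 0 then (-1 : ℝ) else 1) * v i * w i) ^ 2 < 0 ∨
    ∃ c : ℝ, w = c • v := by
  rcases n with - | m
  · simp at hv
  simp only [Fin.sum_univ_succ, Fin.val_zero, Fin.val_succ, Nat.add_eq_zero_iff, one_ne_zero,
    and_false, if_true, if_false, one_mul] at hv ⊢
  set p := ∑ i : Fin m, v i.succ * v i.succ with hp
  set q := ∑ i : Fin m, w i.succ * w i.succ with hq
  set r := ∑ i : Fin m, v i.succ * w i.succ with hr
  have hp0 : 0 ≤ p := Finset.sum_nonneg fun i _ => mul_self_nonneg _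
  have hv0 : v 0 ≠ 0 := by
    intro h0
    rw [h0] at hv
    linarith
  have hy : ∑ i : Fin m, (v 0 * w i.succ - w 0 * v i.succ) ^ 2 =
      v 0 ^ 2 * q - 2 * v 0 * w 0 * r + w 0 ^ 2 * p := by
    rw [hp, hq, hr, Finset.mul_sum, Finset.mul_sum, Finset.mul_sum, ← Finset.sum_sub_distrib,
      ← Finset.sum_add_distrib]
    exact Finset.sum_congr rfl fun i _ => by ring
  -- Replacing `w` by `v₀ w - w₀ v`, whose time component is zero, multiplies the Gram determinant
  -- by `v₀²`; the right side is the Gram determinant of the new pair.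
  have key : v 0 ^ 2 * ((-1 * v 0 * v 0 + p) * (-1 * w 0 * w 0 + q) - (-1 * v 0 * w 0 + r) ^ 2) =
      -((v 0 ^ 2 - p) * ∑ i : Fin m, (v 0 * w i.succ - w 0 * v i.succ) ^ 2) -
        (v 0 * r - w 0 * p) ^ 2 := by
    rw [hy]; ring
  have hy0 : 0 ≤ ∑ i : Fin m, (v 0 * w i.succ - w 0 * v i.succ) ^ 2 :=
    Finset.sum_nonneg fun i _ => sq_nonneg _
  rcases hy0.eq_or_lt with h | h
  · right
    have h2 := (Finset.sum_eq_zero_iff_of_nonneg fun i _ => sq_nonneg _).1 h.symm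
    refine ⟨w 0 / v 0, funext fun i => ?_⟩
    refine Fin.cases ?_ (fun i => ?_) i
    · simp [hv0]
    · have := pow_eq_zero_iff (two_ne_zero) |>.1 (h2 i (Finset.mem_univ i))
      simp only [Pi.smul_apply, smul_eq_mul]
      field_simp
      linarith
  · left
    have h3 : 0 < v 0 ^ 2 := by positivity
    have h4 : 0 < (v 0 ^ 2 - p) * ∑ i : Fin m, (v 0 * w i.succ - w 0 * v i.succ) ^ 2 :=
      mul_pos (by linarith) h
    refine neg_of_mul_neg_right (a := v 0 ^ 2) ?_ h3.le
    rw [key]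
    linarith [sq_nonneg (v 0 * r - w 0 * p)]

theorem gForm_eq_dotProduct (ℓ : Coord n → Coord n → ℝ) (x v a b : Coord n) :
    gForm ℓ x v a b = a.ofLp ⬝ᵥ (gMatrix ℓ x v).mulVec b.ofLp := by
  simp only [gForm, dotProduct, Matrix.mulVec, gMatrix, Matrix.of_apply, Finset.mul_sum]
  exact Finset.sum_congr rfl fun i _ => Finset.sum_congr rfl fun j _ => by ring

/-- The reverse Cauchy–Schwarz inequality, with its case of equality. -/
theorem HasLorentzSignature.reverse_cauchySchwarz {ℓ : Coord n → Coord n → ℝ} {x v : Coord n}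
    (h : HasLorentzSignature (gMatrix ℓ x v)) {a : Coord n} (ha : gForm ℓ x v a a < 0)
    (b : Coord n) :
    gForm ℓ x v a a * gForm ℓ x v b b - gForm ℓ x v a b ^ 2 < 0 ∨ ∃ c : ℝ, b = c • a := by
  obtain ⟨P, hP, hd⟩ := h
  have e1 : ∀ a : Fin n → ℝ, P.mulVec (P⁻¹.mulVec a) = a := fun a => by
    rw [Matrix.mulVec_mulVec, Matrix.mul_nonsing_inv _ hP, Matrix.one_mulVec]
  -- In the coordinates `P⁻¹ a` the form is the standard Minkowski form.
  have e2 : ∀ a b : Coord n, gForm ℓ x v a b =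
      ∑ i : Fin n, (if (i : ℕ) = 0 then (-1 : ℝ) else 1) * P⁻¹.mulVec a.ofLp i *
        P⁻¹.mulVec b.ofLp i := by
    intro a b
    rw [gForm_eq_dotProduct]
    conv_lhs => rw [← e1 a.ofLp, ← e1 b.ofLp]
    rw [Matrix.dotProduct_mulVec, Matrix.vecMul_mulVec, ← Matrix.dotProduct_mulVec,
      Matrix.dotProduct_mulVec, ← Matrix.dotProduct_mulVec, Matrix.mulVec_mulVec, hd]
    simp only [dotProduct, Matrix.mulVec_diagonal]
    exact Finset.sum_congr rfl fun i _ => by ring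
  rw [e2] at ha
  rw [e2, e2, e2]
  refine (minkowski_reverse_cauchySchwarz _ _ ha).imp id fun ⟨c, hc⟩ => ⟨c, ?_⟩
  have := congrArg P.mulVec hc
  rw [Matrix.mulVec_smul, e1, e1] at this
  ext i
  exact congrFun this i

theorem HasLorentzSignature.reverse_cauchySchwarz_le {ℓ : Coord n → Coord n → ℝ} {x v : Coord n}
    (h : HasLorentzSignature (gMatrix ℓ x v)) {a : Coord n} (ha : gForm ℓ x v a a < 0)
    (b : Coord n) : gForm ℓ x v a a * gForm ℓ x v b b - gForm ℓ x v a b ^ 2 ≤ 0 := by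
  rcases h.reverse_cauchySchwarz ha b with h1 | ⟨c, rfl⟩
  · exact h1.le
  · simp only [gForm_eq_dotProduct, WithLp.ofLp_smul, Matrix.mulVec_smul, smul_dotProduct,
      dotProduct_smul, smul_eq_mul]
    exact le_of_eq (by ring)

end ReverseCauchySchwarz

/-! ### Two calculus lemmas: mixed partial derivatives and `√(-2q)` -/

section Calculus

/-- Interchange of partial derivatives: if `∂f/∂t = A` is strictly differentiable, then `∂f/∂s` has
the `t`-derivative `∂A/∂s`. -/
theorem hasDerivAt_partial_of_hasStrictFDerivAt {E : Type*} [NormedAddCommGroup E]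
    [NormedSpace ℝ E] {f A : ℝ × ℝ → E} {A' : ℝ × ℝ →L[ℝ] E} {t s : ℝ}
    (hf : ∀ᶠ p in nhds (t, s), DifferentiableAt ℝ f p)
    (hfA : ∀ᶠ p in nhds (t, s), fderiv ℝ f p (1, 0) = A p)
    (hA : HasStrictFDerivAt A A' (t, s)) :
    HasDerivAt (fun r => fderiv ℝ f (r, s) (0, 1)) (A' (0, 1)) t := by
  rw [hasDerivAt_iff_isLittleO, Asymptotics.isLittleO_iff]
  intro c hc
  -- Strictness is essential: `A` will be compared at `(ρ, s')` and `(ρ, s)`, neither of which need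
  -- be the base point.
  have h1 := (Asymptotics.isLittleO_iff.1 hA.isLittleO) hc
  rw [nhds_prod_eq, Filter.eventually_prod_self_iff'] at h1
  obtain ⟨u, hu, h1⟩ := h1
  obtain ⟨δ, hδ, hball⟩ := Metric.mem_nhds_iff.1 (Filter.inter_mem hu (hf.and hfA))
  have hmem : ∀ r ∈ Metric.ball t δ, ∀ s' ∈ Metric.ball s δ,
      (r, s') ∈ u ∧ DifferentiableAt ℝ f (r, s') ∧ fderiv ℝ f (r, s') (1, 0) = A (r, s') := by
    intro r hr s' hs'
    exact hball (by rw [← ball_prod_same]; exact ⟨hr, hs'⟩)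
  have hs0 : s ∈ Metric.ball s δ := Metric.mem_ball_self hδ
  have ht0 : t ∈ Metric.ball t δ := Metric.mem_ball_self hδ
  have dt : ∀ r ∈ Metric.ball t δ, ∀ s' ∈ Metric.ball s δ,
      HasDerivAt (fun ρ => f (ρ, s')) (A (r, s')) r := by
    intro r hr s' hs'
    obtain ⟨-, h2, h3⟩ := hmem r hr s' hs'
    rw [← h3]
    exact h2.hasFDerivAt.comp_hasDerivAt r ((hasDerivAt_id r).prodMk (hasDerivAt_const r s'))
  have ds : ∀ r ∈ Metric.ball t δ,
      HasDerivAt (fun s' => f (r, s')) (fderiv ℝ f (r, s) (0, 1)) s := by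
    intro r hr
    exact (hmem r hr s hs0).2.1.hasFDerivAt.comp_hasDerivAt s
      ((hasDerivAt_const s r).prodMk (hasDerivAt_id s))
  filter_upwards [Metric.ball_mem_nhds t hδ] with r hr
  -- The mixed second difference of `f`, corrected by its expected value. A Lipschitz bound for it
  -- at `s` bounds its `s`-derivative, and that bound comes from the mean value inequality in `t`.
  have hD : HasDerivAt (fun s' => f (r, s') - f (t, s') - (s' - s) • ((r - t) • A' (0, 1)))
      (fderiv ℝ f (r, s) (0, 1) - fderiv ℝ f (t, s) (0, 1) - (r - t) • A' (0, 1)) s := by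
    have h3 := ((hasDerivAt_id s).sub_const s).smul_const ((r - t) • A' (0, 1))
    rw [one_smul] at h3
    exact ((ds r hr).sub (ds t ht0)).sub h3
  refine hD.le_of_lip' (by positivity) ?_
  filter_upwards [Metric.ball_mem_nhds s hδ] with s' hs'
  have hφ : ∀ ρ ∈ Metric.ball t δ, HasDerivWithinAt
      (fun ρ => f (ρ, s') - f (ρ, s) - (ρ - t) • ((s' - s) • A' (0, 1)))
      (A (ρ, s') - A (ρ, s) - (s' - s) • A' (0, 1)) (Metric.ball t δ) ρ := by
    intro ρ hρ
    have h3 := ((hasDerivAt_id ρ).sub_const t).smul_const ((s' - s) • A' (0, 1))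
    rw [one_smul] at h3
    exact (((dt ρ hρ s' hs').sub (dt ρ hρ s hs0)).sub h3).hasDerivWithinAt
  have hb : ∀ ρ ∈ Metric.ball t δ,
      ‖A (ρ, s') - A (ρ, s) - (s' - s) • A' (0, 1)‖ ≤ c * ‖s' - s‖ := by
    intro ρ hρ
    have h3 := h1 _ (hmem ρ hρ s' hs').1 _ (hmem ρ hρ s hs0).1
    have e : ((ρ, s') - (ρ, s) : ℝ × ℝ) = (s' - s) • (0, 1) := by simp
    simp only [e, map_smul, norm_smul] at h3
    simpa [Prod.norm_def] using h3
  have h4 := (convex_ball t δ).norm_image_sub_le_of_norm_hasDerivWithin_le hφ hb ht0 hr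
  have e : f (r, s') - f (t, s') - (s' - s) • (r - t) • A' (0, 1) -
      (f (r, s) - f (t, s) - (s - s) • (r - t) • A' (0, 1)) =
      f (r, s') - f (r, s) - (r - t) • (s' - s) • A' (0, 1) -
        (f (t, s') - f (t, s) - (t - t) • (s' - s) • A' (0, 1)) := by
    rw [smul_comm (s' - s)]
    simp only [sub_self, zero_smul, sub_zero]
    abel
  rw [e]
  refine h4.trans (le_of_eq (by ring))

/-- The second derivative of `√(-2q)`. -/
theorem hasDerivAt_sqrt_second {q q' : ℝ → ℝ} {q'' t : ℝ}
    (hq : ∀ᶠ r in nhds t, HasDerivAt q (q' r) r) (hq' : HasDerivAt q' q'' t) (hneg : q t < 0) :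
    (∀ᶠ r in nhds t, HasDerivAt (fun r => √(-2 * q r)) (-q' r / √(-2 * q r)) r) ∧
    HasDerivAt (fun r => -q' r / √(-2 * q r))
      ((2 * q t * q'' - q' t ^ 2) / √(-2 * q t) ^ 3) t := by
  have hcont : ContinuousAt q t := hq.self_of_nhds.continuousAt
  have h1 : ∀ r, q r < 0 → HasDerivAt q (q' r) r →
      HasDerivAt (fun r => √(-2 * q r)) (-q' r / √(-2 * q r)) r := by
    intro r hr hd
    have h2 := (hd.const_mul (-2)).sqrt (by linarith : -2 * q r ≠ 0)
    convert h2 using 1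
    have : √(-2 * q r) ≠ 0 := (Real.sqrt_pos.2 (by linarith)).ne'
    field_simp
  refine ⟨?_, ?_⟩
  · filter_upwards [hq, hcont.eventually (gt_mem_nhds hneg)] with r hr hr2 using h1 r hr2 hr
  · have hs : 0 < √(-2 * q t) := Real.sqrt_pos.2 (by linarith)
    have h3 := hq'.neg.div (h1 t hneg hq.self_of_nhds) hs.ne'
    refine h3.congr_deriv ?_
    have h4 : √(-2 * q t) ^ 2 = -2 * q t := Real.sq_sqrt (by linarith)
    have h5 : 2 * q t = - √(-2 * q t) ^ 2 := by linarith
    rw [h5]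
    simp only [Pi.neg_apply]
    field_simp

end Calculus

/-! ### Jacobi equation and second variation in a chart -/

section GeodesicVariation

variable {n : ℕ} {W : Set (Coord n)} {ℓ : Coord n → Coord n → ℝ} {v₀ : Coord n}

/-- `c` is a variation through geodesics, on the open parameter domain `O`, with values in `W` and
with nonvanishing variation field. -/
structure IsCoordGeodesicVariation (W : Set (Coord n))
    (B : Coord n → Coord n →L[ℝ] Coord n →L[ℝ] Coord n) (O : Set (ℝ × ℝ))
    (c : ℝ × ℝ → Coord n) : Prop where
  isOpen : IsOpen O
  contDiffOn : ContDiffOn ℝ 2 c O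
  mapsTo : ∀ p ∈ O, c p ∈ W
  variation_ne_zero : ∀ p ∈ O, fderiv ℝ c p (0, 1) ≠ 0
  geodesic : ∀ p ∈ O, fderiv ℝ (fun p => fderiv ℝ c p (1, 0)) p (1, 0) =
    -B (c p) (fderiv ℝ c p (1, 0)) (fderiv ℝ c p (1, 0))

/-- The covariant derivative along the geodesics of the variation field. -/
def covDerivVariation (B : Coord n → Coord n →L[ℝ] Coord n →L[ℝ] Coord n)
    (c : ℝ × ℝ → Coord n) (p : ℝ × ℝ) : Coord n :=
  fderiv ℝ (fun p => fderiv ℝ c p (1, 0)) p (0, 1) +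
    B (c p) (fderiv ℝ c p (1, 0)) (fderiv ℝ c p (0, 1))

theorem hasDerivAt_slice {E : Type*} [NormedAddCommGroup E] [NormedSpace ℝ E] {f : ℝ × ℝ → E}
    {t s : ℝ} (hf : DifferentiableAt ℝ f (t, s)) :
    HasDerivAt (fun r => f (r, s)) (fderiv ℝ f (t, s) (1, 0)) t :=
  hf.hasFDerivAt.comp_hasDerivAt t ((hasDerivAt_id t).prodMk (hasDerivAt_const t s))

theorem HasFDerivAt.hasDerivAt_comp {E F : Type*} [NormedAddCommGroup E] [NormedSpace ℝ E]
    [NormedAddCommGroup F] [NormedSpace ℝ F] {B : E → F} {B' : E →L[ℝ] F} {c : ℝ → E} {c' : E}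
    {t : ℝ} (hB : HasFDerivAt B B' (c t)) (hc : HasDerivAt c c' t) :
    HasDerivAt (fun r => B (c r)) (B' c') t :=
  hB.comp_hasDerivAt t hc

theorem hasDerivAt_bilin_comp {E : Type*} [NormedAddCommGroup E] [NormedSpace ℝ E]
    {B : E → E →L[ℝ] E →L[ℝ] E} {B' : E →L[ℝ] E →L[ℝ] E →L[ℝ] E} {c : ℝ → E} {c' : E} {t : ℝ}
    (hB : HasFDerivAt B B' (c t)) (hc : HasDerivAt c c' t) :
    HasDerivAt (fun r => B (c r)) (B' c') t :=
  HasFDerivAt.hasDerivAt_comp (F := E →L[ℝ] E →L[ℝ] E) (B := B) (B' := B') hB hc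

namespace IsCoordGeodesicVariation

variable {O : Set (ℝ × ℝ)} {c : ℝ × ℝ → Coord n}
  {B : Coord n → Coord n →L[ℝ] Coord n →L[ℝ] Coord n}

theorem contDiffOn_fderiv_apply (h : IsCoordGeodesicVariation W B O c) (e : ℝ × ℝ) :
    ContDiffOn ℝ 1 (fun p => fderiv ℝ c p e) O :=
  (h.contDiffOn.fderiv_of_isOpen h.isOpen (by norm_num)).clm_apply contDiffOn_const

theorem differentiableAt_fderiv_apply (h : IsCoordGeodesicVariation W B O c) (e : ℝ × ℝ)
    {p : ℝ × ℝ} (hp : p ∈ O) : DifferentiableAt ℝ (fun p => fderiv ℝ c p e) p :=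
  ((h.contDiffOn_fderiv_apply e).contDiffAt (h.isOpen.mem_nhds hp)).differentiableAt (by simp)

theorem differentiableAt (h : IsCoordGeodesicVariation W B O c) {p : ℝ × ℝ} (hp : p ∈ O) :
    DifferentiableAt ℝ c p :=
  (h.contDiffOn.contDiffAt (h.isOpen.mem_nhds hp)).differentiableAt (by simp)

theorem fderiv_variation (h : IsCoordGeodesicVariation W B O c) {p : ℝ × ℝ} (hp : p ∈ O) :
    fderiv ℝ (fun p => fderiv ℝ c p (0, 1)) p (1, 0) =
      fderiv ℝ (fun p => fderiv ℝ c p (1, 0)) p (0, 1) := by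
  have h1 : DifferentiableAt ℝ (fderiv ℝ c) p :=
    ((h.contDiffOn.fderiv_of_isOpen h.isOpen (m := 1) (by norm_num)).contDiffAt
      (h.isOpen.mem_nhds hp)).differentiableAt (by simp)
  have h2 := (h.contDiffOn.contDiffAt (h.isOpen.mem_nhds hp)).isSymmSndFDerivAt (by simp)
  have h3 : ∀ e d : ℝ × ℝ, fderiv ℝ (fun p => fderiv ℝ c p e) p d =
      fderiv ℝ (fderiv ℝ c) p d e := by
    intro e d
    rw [(h1.hasFDerivAt.clm_apply (hasFDerivAt_const e p)).fderiv]
    simp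
  rw [h3, h3]
  exact h2 _ _

theorem hasDerivAt_variation (h : IsCoordGeodesicVariation W B O c) {t s : ℝ} (hp : (t, s) ∈ O) :
    HasDerivAt (fun r => fderiv ℝ c (r, s) (0, 1))
      (fderiv ℝ (fun p => fderiv ℝ c p (1, 0)) (t, s) (0, 1)) t := by
  rw [← h.fderiv_variation hp]
  exact hasDerivAt_slice (h.differentiableAt_fderiv_apply _ hp)

theorem hasDerivAt_velocity (h : IsCoordGeodesicVariation W B O c) {t s : ℝ} (hp : (t, s) ∈ O) :
    HasDerivAt (fun r => fderiv ℝ c (r, s) (1, 0))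
      (-B (c (t, s)) (fderiv ℝ c (t, s) (1, 0)) (fderiv ℝ c (t, s) (1, 0))) t := by
  rw [← h.geodesic _ hp]
  exact hasDerivAt_slice (h.differentiableAt_fderiv_apply _ hp)

theorem hasDerivAt_base (h : IsCoordGeodesicVariation W B O c) {t s : ℝ} (hp : (t, s) ∈ O) :
    HasDerivAt (fun r => c (r, s)) (fderiv ℝ c (t, s) (1, 0)) t :=
  hasDerivAt_slice (h.differentiableAt hp)

/-- The Jacobi equation, in the form in which it arises by differentiating the geodesic equation. -/
theorem hasDerivAt_fderiv_velocity (h : IsCoordGeodesicVariation W B O c) {t s : ℝ}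
    (hW : IsOpen W) (hB : ContDiffOn ℝ ∞ B W) (hp : (t, s) ∈ O) :
    HasDerivAt (fun r => fderiv ℝ (fun p => fderiv ℝ c p (1, 0)) (r, s) (0, 1))
      (-(fderiv ℝ B (c (t, s)) (fderiv ℝ c (t, s) (0, 1)) (fderiv ℝ c (t, s) (1, 0))
          (fderiv ℝ c (t, s) (1, 0)) +
        B (c (t, s)) (fderiv ℝ (fun p => fderiv ℝ c p (1, 0)) (t, s) (0, 1))
          (fderiv ℝ c (t, s) (1, 0)) +
        B (c (t, s)) (fderiv ℝ c (t, s) (1, 0))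
          (fderiv ℝ (fun p => fderiv ℝ c p (1, 0)) (t, s) (0, 1)))) t := by
  have hT := h.contDiffOn_fderiv_apply (1, 0)
  have hA : ContDiffOn ℝ 1
      (fun p => -B (c p) (fderiv ℝ c p (1, 0)) (fderiv ℝ c p (1, 0))) O :=
    ((((hB.of_le (by exact_mod_cast le_top)).comp (h.contDiffOn.of_le (by norm_num))
      h.mapsTo).clm_apply hT).clm_apply hT).neg
  -- The right side of the geodesic equation is `C¹`, hence strictly differentiable; this supplies
  -- the third derivative of `c` that `C²` regularity alone does not.
  have hA1 := (hA.contDiffAt (h.isOpen.mem_nhds hp)).hasStrictFDerivAt (by simp)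
  have key := hasDerivAt_partial_of_hasStrictFDerivAt
    (f := fun p => fderiv ℝ c p (1, 0)) (by
      filter_upwards [h.isOpen.mem_nhds hp] with p hp
      exact h.differentiableAt_fderiv_apply _ hp)
    (by
      filter_upwards [h.isOpen.mem_nhds hp] with p hp
      exact h.geodesic p hp) hA1
  refine key.congr_deriv ?_
  have hs : HasDerivAt (fun r : ℝ => ((t, r) : ℝ × ℝ)) (0, 1) s :=
    (hasDerivAt_const s t).prodMk (hasDerivAt_id s)
  have hc1 : HasDerivAt (fun r => c (t, r)) (fderiv ℝ c (t, s) (0, 1)) s :=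
    (h.differentiableAt hp).hasFDerivAt.comp_hasDerivAt s hs
  have hT1 : HasDerivAt (fun r => fderiv ℝ c (t, r) (1, 0))
      (fderiv ℝ (fun p => fderiv ℝ c p (1, 0)) (t, s) (0, 1)) s :=
    (h.differentiableAt_fderiv_apply (1, 0) hp).hasFDerivAt.comp_hasDerivAt s hs
  have hB1 : HasDerivAt (fun r => B (c (t, r)))
      (fderiv ℝ B (c (t, s)) (fderiv ℝ c (t, s) (0, 1))) s :=
    hasDerivAt_bilin_comp (c := fun r => c (t, r))
      ((hB.contDiffAt (hW.mem_nhds (h.mapsTo _ hp))).differentiableAt (by simp)).hasFDerivAt hc1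
  have h1 := ((hB1.clm_apply hT1).clm_apply hT1).neg
  have h2 := hA1.hasFDerivAt.comp_hasDerivAt s hs
  rw [h2.unique h1]
  simp

end IsCoordGeodesicVariation

section Berwald

variable {O : Set (ℝ × ℝ)} {c : ℝ × ℝ → Coord n}

/-- The chain rule, where the horizontal part of the derivative of `(c, V)` is lost because `L` is
parallel. -/
theorem IsCoordGeodesicVariation.hasDerivAt_norm (hℓ : IsCoordBerwald W ℓ) (hv₀ : v₀ ≠ 0)
    (h : IsCoordGeodesicVariation W (chernForm ℓ v₀) O c) {t s : ℝ} (hp : (t, s) ∈ O) :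
    HasDerivAt (fun r => ℓ (c (r, s)) (fderiv ℝ c (r, s) (0, 1)))
      (jointDeriv ℓ (c (t, s), fderiv ℝ c (t, s) (0, 1))
        (0, covDerivVariation (chernForm ℓ v₀) c (t, s))) t := by
  have hx := h.mapsTo _ hp
  have hv := h.variation_ne_zero _ hp
  have h1 := (hℓ.smooth.hasFDerivAt hℓ.isOpen hx hv).comp_hasDerivAt t
    ((h.hasDerivAt_base hp).prodMk (h.hasDerivAt_variation hp))
  rw [hℓ.jointDeriv_pos hv₀ hx hv] at h1
  exact h1

/-- The Jacobi equation `D_t Y = -R(V, T)T`, with the connection term `B(T, Y)` moved to the right.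
-/
theorem IsCoordGeodesicVariation.hasDerivAt_covDerivVariation (hℓ : IsCoordBerwald W ℓ)
    (hv₀ : v₀ ≠ 0) (h : IsCoordGeodesicVariation W (chernForm ℓ v₀) O c) {t s : ℝ}
    (hp : (t, s) ∈ O) :
    HasDerivAt (fun r => covDerivVariation (chernForm ℓ v₀) c (r, s))
      (-affineCurv (chernForm ℓ v₀) (c (t, s)) (fderiv ℝ c (t, s) (0, 1))
          (fderiv ℝ c (t, s) (1, 0)) (fderiv ℝ c (t, s) (1, 0)) -
        chernForm ℓ v₀ (c (t, s)) (fderiv ℝ c (t, s) (1, 0))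
          (covDerivVariation (chernForm ℓ v₀) c (t, s))) t := by
  have hx := h.mapsTo _ hp
  have hB1 := hasDerivAt_bilin_comp (c := fun r => c (r, s)) (hℓ.hasFDerivAt_chernForm hv₀ hx)
    (h.hasDerivAt_base hp)
  have h1 := (h.hasDerivAt_fderiv_velocity hℓ.isOpen (hℓ.contDiffOn_chernForm hv₀) hp).add
    ((hB1.clm_apply (h.hasDerivAt_velocity hp)).clm_apply (h.hasDerivAt_variation hp))
  refine h1.congr_deriv ?_
  simp only [affineCurv, covDerivVariation, add_apply, map_add, map_neg, neg_apply]
  rw [hℓ.fderiv_chernForm_symm hv₀ hx _ (fderiv ℝ c (t, s) (0, 1)) (fderiv ℝ c (t, s) (1, 0)),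
    hℓ.chernForm_symm hv₀ hx (fderiv ℝ (fun p => fderiv ℝ c p (1, 0)) (t, s) (0, 1)),
    hℓ.chernForm_symm hv₀ hx (fderiv ℝ c (t, s) (0, 1)),
    hℓ.chernForm_symm hv₀ hx (fderiv ℝ c (t, s) (0, 1)) (fderiv ℝ c (t, s) (1, 0))]
  abel

/-- The second variation of `L(V)`. -/
theorem IsCoordGeodesicVariation.hasDerivAt_norm_deriv (hℓ : IsCoordBerwald W ℓ) (hv₀ : v₀ ≠ 0)
    (h : IsCoordGeodesicVariation W (chernForm ℓ v₀) O c) {t s : ℝ} (hp : (t, s) ∈ O) :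
    HasDerivAt (fun r => jointDeriv ℓ (c (r, s), fderiv ℝ c (r, s) (0, 1))
        (0, covDerivVariation (chernForm ℓ v₀) c (r, s)))
      (gForm ℓ (c (t, s)) (fderiv ℝ c (t, s) (0, 1))
          (covDerivVariation (chernForm ℓ v₀) c (t, s))
          (covDerivVariation (chernForm ℓ v₀) c (t, s)) -
        gForm ℓ (c (t, s)) (fderiv ℝ c (t, s) (0, 1))
          (curvOp ℓ (c (t, s)) (fderiv ℝ c (t, s) (0, 1)) (fderiv ℝ c (t, s) (1, 0)))
          (fderiv ℝ c (t, s) (1, 0))) t := by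
  have hx := h.mapsTo _ hp
  have hv := h.variation_ne_zero _ hp
  have h1 := (hℓ.smooth.jointDeriv_jointDeriv hℓ.isOpen hx hv).comp_hasDerivAt t
    ((h.hasDerivAt_base hp).prodMk (h.hasDerivAt_variation hp))
  have h2 := h1.clm_apply
    ((hasDerivAt_const t (0 : Coord n)).prodMk (h.hasDerivAt_covDerivVariation hℓ hv₀ hp))
  refine h2.congr_deriv ?_
  rw [hℓ.smooth.gForm_eq hℓ.isOpen hx hv, hℓ.smooth.gForm_eq hℓ.isOpen hx hv,
    hℓ.curvOp_eq hv₀ hx hv]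
  simp only [Function.comp_apply]
  set B := chernForm ℓ v₀
  set x := c (t, s)
  set T := fderiv ℝ c (t, s) (1, 0)
  set V := fderiv ℝ c (t, s) (0, 1)
  set V' := fderiv ℝ (fun p => fderiv ℝ c p (1, 0)) (t, s) (0, 1)
  have hY : covDerivVariation B c (t, s) = V' + B x T V := rfl
  set Y := covDerivVariation B c (t, s)
  -- Split into a vertical and a horizontal part. The vertical part yields `g_V(Y, Y)`; by `e2` the
  -- horizontal one yields `dℓ(B(T, Y))`, which cancels the connection term in the derivative of
  -- `Y`.
  have e1 : ((T, V') : Coord n × Coord n) = (0, Y) + (T, -B x T V) := by simp [hY]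
  have e2 := hℓ.fderiv_jointDeriv_horizontal hv₀ hx hv T 0 Y
  rw [map_zero, zero_apply, zero_apply, zero_add, hℓ.smooth.jointDeriv_symm hℓ.isOpen hx hv] at e2
  -- Skewness turns the remaining `dℓ_V(R(V, T)T)` into `g_V(R(T, V)V, T)`, the flag curvature
  -- numerator with flagpole `V`.
  have e3 := hℓ.gForm_affineCurv_skew hv₀ hx hv V T T
  have e4 : affineCurv B x V T V = - affineCurv B x T V V := by
    simp only [affineCurv]; abel
  have e5 : ((0, -affineCurv B x V T T - B x T Y) : Coord n × Coord n) =
      -(0, affineCurv B x V T T) - (0, B x T Y) := by simp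
  have e6 : ((0, -affineCurv B x T V V) : Coord n × Coord n) = -(0, affineCurv B x T V V) := by
    simp
  rw [e4, e6, map_neg, hℓ.smooth.jointDeriv_symm hℓ.isOpen hx hv] at e3
  rw [e1, map_add, add_apply, e2, e5, map_sub, map_neg]
  linarith

/-- Along a variation through geodesics, `√(-2 L(V))` has a nonpositive second derivative wherever
`V` is timelike and the curvature term is nonpositive. -/
theorem IsCoordGeodesicVariation.sqrt_second_nonpos (hℓ : IsCoordBerwald W ℓ) (hv₀ : v₀ ≠ 0)
    (h : IsCoordGeodesicVariation W (chernForm ℓ v₀) O c) {t s : ℝ} (hp : (t, s) ∈ O)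
    (hneg : ℓ (c (t, s)) (fderiv ℝ c (t, s) (0, 1)) < 0)
    (hcurv : gForm ℓ (c (t, s)) (fderiv ℝ c (t, s) (0, 1))
      (curvOp ℓ (c (t, s)) (fderiv ℝ c (t, s) (0, 1)) (fderiv ℝ c (t, s) (1, 0)))
      (fderiv ℝ c (t, s) (1, 0)) ≤ 0) :
    ∃ (f' : ℝ → ℝ) (f'' : ℝ),
      (∀ᶠ r in nhds t, HasDerivAt
        (fun r => √(-2 * ℓ (c (r, s)) (fderiv ℝ c (r, s) (0, 1)))) (f' r) r) ∧
      HasDerivAt f' f'' t ∧ f'' ≤ 0 := by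
  have hx := h.mapsTo _ hp
  have hv := h.variation_ne_zero _ hp
  have hO : ∀ᶠ r in nhds t, (r, s) ∈ O :=
    (Continuous.continuousAt (by fun_prop : Continuous fun r : ℝ => (r, s))).eventually
      (h.isOpen.mem_nhds hp)
  obtain ⟨h1, h2⟩ := hasDerivAt_sqrt_second
    (hO.mono fun r hr => h.hasDerivAt_norm hℓ hv₀ hr) (h.hasDerivAt_norm_deriv hℓ hv₀ hp) hneg
  refine ⟨_, _, h1, h2, div_nonpos_of_nonpos_of_nonneg ?_ (by positivity)⟩
  have hVV : gForm ℓ (c (t, s)) (fderiv ℝ c (t, s) (0, 1)) (fderiv ℝ c (t, s) (0, 1))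
      (fderiv ℝ c (t, s) (0, 1)) = 2 * ℓ (c (t, s)) (fderiv ℝ c (t, s) (0, 1)) := by
    rw [hℓ.gForm_self_left hx hv, hℓ.jointDeriv_self hx hv]
  have hcs := (hℓ.signature _ hx _ hv).reverse_cauchySchwarz_le (by rw [hVV]; linarith)
    (covDerivVariation (chernForm ℓ v₀) c (t, s))
  rw [hVV, hℓ.gForm_self_left hx hv] at hcs
  have := mul_nonneg_of_nonpos_of_nonpos hneg.le hcurv
  nlinarith

end Berwald

end GeodesicVariation

/-! ### From the manifold to charts -/

section LocalRepresentation

theorem contMDiff_totalSpace_mk {E : Type*} [NormedAddCommGroup E] [NormedSpace ℝ E] {k : ℕ∞ω} :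
    ContMDiff 𝓘(ℝ, E × E) 𝓘(ℝ, E).tangent k
      (fun p : E × E => (⟨p.1, p.2⟩ : TangentBundle 𝓘(ℝ, E) E)) := by
  intro p
  rw [Bundle.contMDiffAt_totalSpace]
  refine ⟨contMDiffAt_iff_contDiffAt.2 contDiffAt_fst, ?_⟩
  exact contMDiffAt_iff_contDiffAt.2
    (contDiffAt_snd.congr_of_eventuallyEq (.of_forall fun q => by simp))

variable {n : ℕ} {M : Type*} [TopologicalSpace M] [ChartedSpace (Coord n) M]
  {L : TangentBundle 𝓘(ℝ, Coord n) M → ℝ}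
  {X : ∀ x : M, TangentSpace 𝓘(ℝ, Coord n) x} {φ : OpenPartialHomeomorph M (Coord n)}

theorem mdifferentiable_of_mem_smoothCharts (hφ : φ ∈ smoothCharts (n := n) M) :
    φ.MDifferentiable 𝓘(ℝ, Coord n) 𝓘(ℝ, Coord n) :=
  ⟨(contMDiffOn_of_mem_maximalAtlas hφ).mdifferentiableOn (by simp),
    (contMDiffOn_symm_of_mem_maximalAtlas hφ).mdifferentiableOn (by simp)⟩

/-- All tangent spaces are the model space by definition, so vectors at different base points can be
compared without transport. -/
theorem totalSpace_mk_eq {x x' : M} (h : x' = x) (v v' : Coord n) (hv : v' = v) :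
    (⟨x', v'⟩ : TangentBundle 𝓘(ℝ, Coord n) M) = ⟨x, v⟩ := by
  subst h hv
  rfl

theorem localRep_mfderiv (hφ : φ ∈ smoothCharts (n := n) M) {x : M} (hx : x ∈ φ.source)
    (v : TangentSpace 𝓘(ℝ, Coord n) x) :
    localRep L φ (φ x) (mfderiv 𝓘(ℝ, Coord n) 𝓘(ℝ, Coord n) φ x v) = L ⟨x, v⟩ := by
  have h := (mdifferentiable_of_mem_smoothCharts hφ).symm_comp_deriv hx
  exact congrArg L (totalSpace_mk_eq (φ.left_inv hx) v _ (congrArg (fun A => A v) h))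

variable [IsManifold 𝓘(ℝ, Coord n) ∞ M]

theorem IsLorentzFinsler.smoothOffZero_localRep (hL : IsLorentzFinsler L)
    (hφ : φ ∈ smoothCharts (n := n) M) : SmoothOffZero φ.target (localRep L φ) := by
  have h1 : ContMDiffOn 𝓘(ℝ, Coord n).tangent 𝓘(ℝ, Coord n).tangent ∞ _ _ :=
    (contMDiffOn_symm_of_mem_maximalAtlas hφ).contMDiffOn_tangentMapWithin (m := ∞) (by simp)
      φ.open_target.uniqueMDiffOn
  have h2 := h1.comp (contMDiff_totalSpace_mk (E := Coord n)).contMDiffOn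
    (s := φ.target ×ˢ {0}ᶜ) fun p hp => hp.1
  have h3 := hL.smooth.comp h2 fun p hp => by
    have h4 := (mdifferentiable_of_mem_smoothCharts hφ).symm.mfderiv_injective hp.1
    simp only [mem_preimage, mem_ofPred_eq, Function.comp_apply, tangentMapWithin]
    rw [mfderivWithin_of_isOpen φ.open_target hp.1]
    exact fun h0 => hp.2 (h4 (h0.trans (map_zero _).symm))
  refine (contMDiffOn_iff_contDiffOn.1 h3).congr fun p hp => ?_
  simp only [localRep, Function.comp_apply, tangentMapWithin]
  rw [mfderivWithin_of_isOpen φ.open_target hp.1]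

theorem IsBerwaldSpacetime.isCoordBerwald (hB : IsBerwaldSpacetime L X)
    (hφ : φ ∈ smoothCharts (n := n) M) : IsCoordBerwald φ.target (localRep L φ) where
  isOpen := φ.open_target
  smooth := hB.toIsLorentzFinsler.smoothOffZero_localRep hφ
  homogeneous x _ v c hc := by
    simp only [localRep]
    rw [← hB.homogeneous _ _ c hc]
    congr 2
    exact map_smul _ c v
  signature := hB.signature φ hφ
  chern_const := hB.chern_const φ hφ

theorem IsLorentzFinsler.map_zero (hL : IsLorentzFinsler L) (x : M) :
    L ⟨x, (0 : TangentSpace 𝓘(ℝ, Coord n) x)⟩ = 0 := by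
  have h := hL.homogeneous x 0 2 (by norm_num)
  rw [smul_zero] at h
  linarith

theorem IsLorentzFinsler.ne_zero_of_neg (hL : IsLorentzFinsler L) {x : M}
    {v : TangentSpace 𝓘(ℝ, Coord n) x} (hv : L ⟨x, v⟩ < 0) : v ≠ 0 := by
  rintro rfl
  exact absurd hv (by rw [hL.map_zero]; exact lt_irrefl _)

/-- `R(a, b)` is antisymmetric; `v` itself serves as the reference vector. -/
theorem IsCoordBerwald.curvOp_self {W : Set (Coord n)} {ℓ : Coord n → Coord n → ℝ}
    (h : IsCoordBerwald W ℓ) {x v : Coord n} (hx : x ∈ W) (hv : v ≠ 0) (c : ℝ) :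
    curvOp ℓ x v (c • v) = 0 := by
  rw [h.curvOp_eq hv hx hv]
  simp [affineCurv]

theorem gForm_zero_left (ℓ : Coord n → Coord n → ℝ) (x v b : Coord n) : gForm ℓ x v 0 b = 0 := by
  simp [gForm]

/-- Nonnegative flag curvature makes the curvature quadratic form nonpositive, as the plane
spanned by a timelike vector and another vector is Lorentzian. -/
theorem gForm_curvOp_nonpos (hB : IsBerwaldSpacetime L X)
    (hK : NonnegTimelikeFlagCurvature L X) {x : M} {v : TangentSpace 𝓘(ℝ, Coord n) x}
    (hv : IsFutureTimelike L X ⟨x, v⟩) {V : Coord n}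
    (hV : mfderiv 𝓘(ℝ, Coord n) 𝓘(ℝ, Coord n) (chartAt (Coord n) x) x v = V) (T : Coord n) :
    gForm (localRep L (chartAt (Coord n) x)) (chartAt (Coord n) x x) V
      (curvOp (localRep L (chartAt (Coord n) x)) (chartAt (Coord n) x x) V T) T ≤ 0 := by
  have hφ : chartAt (Coord n) x ∈ smoothCharts (n := n) M := IsManifold.chart_mem_maximalAtlas x
  have hs : x ∈ (chartAt (Coord n) x).source := mem_chart_source _ x
  have hℓ := hB.isCoordBerwald hφ
  have hx : chartAt (Coord n) x x ∈ (chartAt (Coord n) x).target := mem_chart_target _ x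
  have hd := mdifferentiable_of_mem_smoothCharts hφ
  obtain ⟨w, hw⟩ := hd.mfderiv_surjective hs T
  have hv0 : v ≠ 0 := hB.toIsLorentzFinsler.ne_zero_of_neg hv.1
  have hL : localRep L (chartAt (Coord n) x) (chartAt (Coord n) x x) V = L ⟨x, v⟩ :=
    hV ▸ localRep_mfderiv hφ hs v
  have hV0 : V ≠ 0 := fun h0 =>
    hv0 (hd.mfderiv_injective hs ((hV.trans h0).trans (map_zero _).symm))
  have hneg : gForm (localRep L (chartAt (Coord n) x)) (chartAt (Coord n) x x) V V V < 0 := by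
    rw [hℓ.gForm_self_left hx hV0, hℓ.jointDeriv_self hx hV0, hL]
    linarith [hv.1]
  -- Either `V` and `T` span a plane with negative Gram determinant, so `K ≥ 0` forces the numerator
  -- to be nonpositive, or `T` is a multiple of `V` and the curvature term vanishes.
  rcases (hℓ.signature _ hx _ hV0).reverse_cauchySchwarz hneg T with h1 | ⟨c, rfl⟩
  · have hind : LinearIndependent ℝ ![v, w] := by
      rw [LinearIndependent.pair_iff' hv0]
      rintro a rfl
      have hT : T = a • V := (hw.symm.trans
        (map_smul (mfderiv 𝓘(ℝ, Coord n) 𝓘(ℝ, Coord n) (chartAt (Coord n) x) x) a v)).trans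
          (congrArg (a • ·) hV)
      rw [hT] at h1
      simp only [gForm_eq_dotProduct, WithLp.ofLp_smul, Matrix.mulVec_smul, smul_dotProduct,
        dotProduct_smul, smul_eq_mul] at h1
      ring_nf at h1
      exact lt_irrefl _ h1
    have h2 : 0 ≤ coordFlagCurvature (localRep L (chartAt (Coord n) x)) (chartAt (Coord n) x x)
        V T := by
      have h3 := hK x v w hv hind
      rwa [flagCurvature, hw, hV] at h3
    rw [coordFlagCurvature] at h2
    by_contra! h3
    exact absurd (div_neg_of_pos_of_neg h3 h1) (not_lt.2 h2)
  · rw [hℓ.curvOp_self hx hV0, gForm_zero_left]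

end LocalRepresentation

/-! ### The variation field on the manifold -/

section Variation

variable {n : ℕ} {M : Type*} [TopologicalSpace M] [ChartedSpace (Coord n) M]
  {L : TangentBundle 𝓘(ℝ, Coord n) M → ℝ} {X : ∀ x : M, TangentSpace 𝓘(ℝ, Coord n) x}
  {φ : OpenPartialHomeomorph M (Coord n)} {ε : ℝ} {σ : ℝ → ℝ → M}

/-- At `t = 0, 1` only a one-sided derivative in `t` is available, but `s` ranges over an open
interval, so the `s`-derivative is two-sided there as well. -/
theorem hasMFDerivAt_slice
    (hσ : ContMDiffOn 𝓘(ℝ, ℝ × ℝ) 𝓘(ℝ, Coord n) 2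
      (fun p : ℝ × ℝ => σ p.1 p.2) (Icc 0 1 ×ˢ Ioo (-ε) ε)) {t s : ℝ} (ht : t ∈ Icc (0 : ℝ) 1)
    (hs : s ∈ Ioo (-ε) ε) :
    HasMFDerivAt 𝓘(ℝ, ℝ) 𝓘(ℝ, Coord n) (fun r => σ t r) s
      ((mfderivWithin 𝓘(ℝ, ℝ × ℝ) 𝓘(ℝ, Coord n) (fun p : ℝ × ℝ => σ p.1 p.2)
        (Icc 0 1 ×ˢ Ioo (-ε) ε) (t, s)).comp (ContinuousLinearMap.inr ℝ ℝ ℝ)) := by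
  have h1 := ((hσ.mdifferentiableOn (by simp)) (t, s) ⟨ht, hs⟩).hasMFDerivWithinAt
  have h2 : HasMFDerivAt 𝓘(ℝ, ℝ) 𝓘(ℝ, ℝ × ℝ) (fun r : ℝ => ((t, r) : ℝ × ℝ)) s
      (ContinuousLinearMap.inr ℝ ℝ ℝ) := (hasFDerivAt_prodMk_right t s).hasMFDerivAt
  exact (HasMFDerivWithinAt.comp s h1 (h2.hasMFDerivWithinAt (s := Ioo (-ε) ε))
    fun r hr => ⟨ht, hr⟩).hasMFDerivAt (Ioo_mem_nhds hs.1 hs.2)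

theorem uniqueDiffOn_strip (ε : ℝ) : UniqueDiffOn ℝ (Icc (0 : ℝ) 1 ×ˢ Ioo (-ε) ε) :=
  (uniqueDiffOn_Icc zero_lt_one).prod isOpen_Ioo.uniqueDiffOn

/-- `V` is the tangent map of `σ` within the strip applied to `(0, 1)`, which is continuous up to
the boundary. -/
theorem continuousOn_variationField [IsManifold 𝓘(ℝ, Coord n) ∞ M]
    (hσ : ContMDiffOn 𝓘(ℝ, ℝ × ℝ) 𝓘(ℝ, Coord n) 2
      (fun p : ℝ × ℝ => σ p.1 p.2) (Icc 0 1 ×ˢ Ioo (-ε) ε)) {s : ℝ} (hs : s ∈ Ioo (-ε) ε) :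
    ContinuousOn (fun t => (variationField σ t s : TangentBundle 𝓘(ℝ, Coord n) M)) (Icc 0 1) := by
  have : IsManifold 𝓘(ℝ, Coord n) 1 M := IsManifold.of_le (n := ∞) (by exact_mod_cast le_top)
  have h1 := hσ.continuousOn_tangentMapWithin (by norm_num)
    (uniqueDiffOn_strip ε).uniqueMDiffOn
  have h2 : Continuous fun t : ℝ =>
      (⟨(t, s), (0, 1)⟩ : TangentBundle 𝓘(ℝ, ℝ × ℝ) (ℝ × ℝ)) :=
    (contMDiff_totalSpace_mk (E := ℝ × ℝ) (k := 0)).continuous.comp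
      (f := fun t : ℝ => (((t, s), (0, 1)) : (ℝ × ℝ) × (ℝ × ℝ))) (by fun_prop)
  refine (h1.comp h2.continuousOn fun t ht => ⟨ht, hs⟩).congr fun t ht => ?_
  refine totalSpace_mk_eq rfl _ _ ?_
  rw [(hasMFDerivAt_slice hσ ht hs).mfderiv]
  rfl

theorem continuousOn_F_variationField [IsManifold 𝓘(ℝ, Coord n) ∞ M] (hL : IsLorentzFinsler L)
    (hσ : ContMDiffOn 𝓘(ℝ, ℝ × ℝ) 𝓘(ℝ, Coord n) 2
      (fun p : ℝ × ℝ => σ p.1 p.2) (Icc 0 1 ×ˢ Ioo (-ε) ε)) {s : ℝ} (hs : s ∈ Ioo (-ε) ε)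
    (hV : ∀ t ∈ Icc (0 : ℝ) 1, L (variationField σ t s) < 0) :
    ContinuousOn (fun t => F L (variationField σ t s)) (Icc 0 1) := by
  refine ((hL.smooth.continuousOn.comp (continuousOn_variationField hσ hs) fun t ht h0 => ?_
    ).const_smul (-2 : ℝ)).sqrt
  exact hL.ne_zero_of_neg (hV t ht) h0

/-- The interior parameters which `σ` maps to the domain of the chart `φ`. -/
def chartDomain (φ : OpenPartialHomeomorph M (Coord n)) (ε : ℝ) (σ : ℝ → ℝ → M) : Set (ℝ × ℝ) :=
  (Ioo 0 1 ×ˢ Ioo (-ε) ε) ∩ (fun p : ℝ × ℝ => σ p.1 p.2) ⁻¹' φ.source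

theorem interior_strip_subset (ε : ℝ) :
    Ioo (0 : ℝ) 1 ×ˢ Ioo (-ε) ε ⊆ Icc 0 1 ×ˢ Ioo (-ε) ε :=
  prod_mono Ioo_subset_Icc_self subset_rfl

theorem isOpen_chartDomain
    (hσ : ContMDiffOn 𝓘(ℝ, ℝ × ℝ) 𝓘(ℝ, Coord n) 2
      (fun p : ℝ × ℝ => σ p.1 p.2) (Icc 0 1 ×ˢ Ioo (-ε) ε)) : IsOpen (chartDomain φ ε σ) :=
  (hσ.continuousOn.mono (interior_strip_subset ε)).isOpen_inter_preimage
    (isOpen_Ioo.prod isOpen_Ioo) φ.open_source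

theorem contDiffOn_chart_comp [IsManifold 𝓘(ℝ, Coord n) ∞ M] (hφ : φ ∈ smoothCharts (n := n) M)
    (hσ : ContMDiffOn 𝓘(ℝ, ℝ × ℝ) 𝓘(ℝ, Coord n) 2
      (fun p : ℝ × ℝ => σ p.1 p.2) (Icc 0 1 ×ˢ Ioo (-ε) ε)) :
    ContDiffOn ℝ 2 (fun p : ℝ × ℝ => φ (σ p.1 p.2)) (chartDomain φ ε σ) := by
  have h1 : ContMDiffOn 𝓘(ℝ, Coord n) 𝓘(ℝ, Coord n) 2 φ φ.source :=
    (contMDiffOn_of_mem_maximalAtlas hφ).of_le (WithTop.coe_le_coe.2 (le_top : (2 : ℕ∞) ≤ ⊤))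
  exact contMDiffOn_iff_contDiffOn.1
    (h1.comp (hσ.mono (inter_subset_left.trans (interior_strip_subset ε))) inter_subset_right)

theorem hasFDerivAt_apply_one_unique {E : Type*} [NormedAddCommGroup E] [NormedSpace ℝ E]
    {f : ℝ → E} {A B : ℝ →L[ℝ] E} {s : ℝ} (hA : HasFDerivAt f A s) (hB : HasFDerivAt f B s) :
    A 1 = B 1 := by
  rw [hA.unique hB]

/-- The variation field `V(t, s)`, as a tangent vector at `σ(t, s)`. -/
def variationVector (σ : ℝ → ℝ → M) (t s : ℝ) : TangentSpace 𝓘(ℝ, Coord n) (σ t s) :=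
  (variationField σ t s : TangentBundle 𝓘(ℝ, Coord n) M).2

theorem mfderiv_chart_variationVector [IsManifold 𝓘(ℝ, Coord n) ∞ M] (hφ : φ ∈ smoothCharts (n := n) M)
    (hσ : ContMDiffOn 𝓘(ℝ, ℝ × ℝ) 𝓘(ℝ, Coord n) 2
      (fun p : ℝ × ℝ => σ p.1 p.2) (Icc 0 1 ×ˢ Ioo (-ε) ε)) {t s : ℝ}
    (hp : (t, s) ∈ chartDomain φ ε σ) :
    mfderiv 𝓘(ℝ, Coord n) 𝓘(ℝ, Coord n) φ (σ t s) (variationVector σ t s) =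
      fderiv ℝ (fun p : ℝ × ℝ => φ (σ p.1 p.2)) (t, s) (0, 1) := by
  have h1 := hasMFDerivAt_slice hσ (Ioo_subset_Icc_self hp.1.1) hp.1.2
  have h2 := ((mdifferentiable_of_mem_smoothCharts hφ).mdifferentiableAt hp.2).hasMFDerivAt
  have h3 : HasFDerivAt (fun r => φ (σ t r))
      ((mfderiv 𝓘(ℝ, Coord n) 𝓘(ℝ, Coord n) φ (σ t s) : Coord n →L[ℝ] Coord n).comp
        (mfderiv 𝓘(ℝ, ℝ) 𝓘(ℝ, Coord n) (fun r => σ t r) s : ℝ →L[ℝ] Coord n)) s :=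
    (HasMFDerivAt.comp s h2 h1.mdifferentiableAt.hasMFDerivAt).hasFDerivAt
  have h4 : DifferentiableAt ℝ (fun p : ℝ × ℝ => φ (σ p.1 p.2)) (t, s) :=
    ((contDiffOn_chart_comp hφ hσ).contDiffAt
      ((isOpen_chartDomain hσ).mem_nhds hp)).differentiableAt (by simp)
  have h5 := h4.hasFDerivAt.comp s (hasFDerivAt_prodMk_right t s)
  exact hasFDerivAt_apply_one_unique h3 h5

theorem L_variationField [IsManifold 𝓘(ℝ, Coord n) ∞ M] (hφ : φ ∈ smoothCharts (n := n) M)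
    (hσ : ContMDiffOn 𝓘(ℝ, ℝ × ℝ) 𝓘(ℝ, Coord n) 2
      (fun p : ℝ × ℝ => σ p.1 p.2) (Icc 0 1 ×ˢ Ioo (-ε) ε)) {t s : ℝ}
    (hp : (t, s) ∈ chartDomain φ ε σ) :
    L (variationField σ t s) = localRep L φ (φ (σ t s))
      (fderiv ℝ (fun p : ℝ × ℝ => φ (σ p.1 p.2)) (t, s) (0, 1)) :=
  (localRep_mfderiv hφ hp.2 (variationVector σ t s)).symm.trans
    (congrArg (localRep L φ (φ (σ t s))) (mfderiv_chart_variationVector hφ hσ hp))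

theorem fderiv_chart_comp_ne_zero [IsManifold 𝓘(ℝ, Coord n) ∞ M] (hL : IsLorentzFinsler L)
    (hφ : φ ∈ smoothCharts (n := n) M)
    (hσ : ContMDiffOn 𝓘(ℝ, ℝ × ℝ) 𝓘(ℝ, Coord n) 2
      (fun p : ℝ × ℝ => σ p.1 p.2) (Icc 0 1 ×ˢ Ioo (-ε) ε)) {t s : ℝ}
    (hp : (t, s) ∈ chartDomain φ ε σ) (hV : L (variationField σ t s) < 0) :
    fderiv ℝ (fun p : ℝ × ℝ => φ (σ p.1 p.2)) (t, s) (0, 1) ≠ 0 := by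
  rw [← mfderiv_chart_variationVector hφ hσ hp]
  exact fun h0 => hL.ne_zero_of_neg (v := variationVector σ t s) hV
    ((mdifferentiable_of_mem_smoothCharts hφ).mfderiv_injective hp.2 (h0.trans (map_zero _).symm))

theorem IsGeodesic.coord_equation {η : ℝ → M} (hη : IsGeodesic L η)
    (hφ : φ ∈ smoothCharts (n := n) M) {t : ℝ} (ht : t ∈ Ioo (0 : ℝ) 1) (hs : η t ∈ φ.source)
    (i : Fin n) : deriv (deriv fun r => φ (η r)) t i +
      ∑ j, ∑ k, chern (localRep L φ) i j k (φ (η t)) (deriv (fun r => φ (η r)) t) *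
        deriv (fun r => φ (η r)) t j * deriv (fun r => φ (η r)) t k = 0 := by
  have h1 : ∀ r ∈ Ioo (0 : ℝ) 1, derivWithin (fun r => φ (η r)) (Icc 0 1) r =
      deriv (fun r => φ (η r)) r := fun r hr =>
    derivWithin_of_mem_nhds (Icc_mem_nhds hr.1 hr.2)
  have h2 : derivWithin (derivWithin (fun r => φ (η r)) (Icc 0 1)) (Icc 0 1) t =
      deriv (deriv fun r => φ (η r)) t := by
    rw [derivWithin_of_mem_nhds (Icc_mem_nhds ht.1 ht.2)]
    refine Filter.EventuallyEq.deriv_eq ?_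
    filter_upwards [Ioo_mem_nhds ht.1 ht.2] with r hr using h1 r hr
  have h3 := hη.equation φ hφ t (Ioo_subset_Icc_self ht) hs i
  rwa [h2, h1 t ht] at h3

theorem isCoordGeodesicVariation [IsManifold 𝓘(ℝ, Coord n) ∞ M] (hB : IsBerwaldSpacetime L X)
    (hφ : φ ∈ smoothCharts (n := n) M)
    (hσ : ContMDiffOn 𝓘(ℝ, ℝ × ℝ) 𝓘(ℝ, Coord n) 2
      (fun p : ℝ × ℝ => σ p.1 p.2) (Icc 0 1 ×ˢ Ioo (-ε) ε))
    (hgeo : ∀ s ∈ Ioo (-ε) ε, IsGeodesic L (fun t => σ t s))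
    (hV : ∀ t ∈ Icc (0 : ℝ) 1, ∀ s ∈ Ioo (-ε) ε, L (variationField σ t s) < 0)
    {v₀ : Coord n} (hv₀ : v₀ ≠ 0) :
    IsCoordGeodesicVariation φ.target (chernForm (localRep L φ) v₀) (chartDomain φ ε σ)
      (fun p : ℝ × ℝ => φ (σ p.1 p.2)) where
  isOpen := isOpen_chartDomain hσ
  contDiffOn := contDiffOn_chart_comp hφ hσ
  mapsTo p hp := φ.map_source hp.2
  variation_ne_zero p hp := fderiv_chart_comp_ne_zero hB.toIsLorentzFinsler hφ hσ hp
    (hV p.1 (Ioo_subset_Icc_self hp.1.1) p.2 hp.1.2)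
  geodesic := by
    rintro ⟨t, s⟩ hp
    have hO := isOpen_chartDomain (φ := φ) hσ
    have hc := contDiffOn_chart_comp hφ hσ
    have hslice : ∀ p ∈ chartDomain φ ε σ, deriv (fun r => φ (σ r p.2)) p.1 =
        fderiv ℝ (fun p : ℝ × ℝ => φ (σ p.1 p.2)) p (1, 0) := fun p hp =>
      (hasDerivAt_slice (f := fun p : ℝ × ℝ => φ (σ p.1 p.2))
        ((hc.contDiffAt (hO.mem_nhds hp)).differentiableAt (by simp))).deriv
    have h1 : DifferentiableAt ℝ
        (fun p => fderiv ℝ (fun p : ℝ × ℝ => φ (σ p.1 p.2)) p (1, 0)) (t, s) :=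
      (((hc.fderiv_of_isOpen hO (m := 1) (by norm_num)).clm_apply contDiffOn_const).contDiffAt
        (hO.mem_nhds hp)).differentiableAt (by simp)
    have h2 : deriv (deriv fun r => φ (σ r s)) t =
        fderiv ℝ (fun p => fderiv ℝ (fun p : ℝ × ℝ => φ (σ p.1 p.2)) p (1, 0)) (t, s) (1, 0) := by
      rw [← (hasDerivAt_slice h1).deriv]
      refine Filter.EventuallyEq.deriv_eq ?_
      filter_upwards [(Continuous.continuousAt
        (by fun_prop : Continuous fun r : ℝ => (r, s))).eventually (hO.mem_nhds hp)] with r hr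
      exact hslice (r, s) hr
    ext i
    have h3 := (hgeo s hp.1.2).coord_equation hφ hp.1.1 hp.2 i
    rw [h2, hslice (t, s) hp,
      (hB.isCoordBerwald hφ).sum_chern_self_eq hv₀ (φ.map_source hp.2)] at h3
    rw [PiLp.neg_apply]
    linarith

/-- Near each interior parameter, the length of the variation field has a nonpositive second
derivative. -/
theorem F_variationField_second_nonpos [IsManifold 𝓘(ℝ, Coord n) ∞ M]
    (hB : IsBerwaldSpacetime L X) (hK : NonnegTimelikeFlagCurvature L X)
    (hσ : ContMDiffOn 𝓘(ℝ, ℝ × ℝ) 𝓘(ℝ, Coord n) 2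
      (fun p : ℝ × ℝ => σ p.1 p.2) (Icc 0 1 ×ˢ Ioo (-ε) ε))
    (hgeo : ∀ s ∈ Ioo (-ε) ε, IsGeodesic L (fun t => σ t s))
    (hV : ∀ t ∈ Icc (0 : ℝ) 1, ∀ s ∈ Ioo (-ε) ε,
      IsFutureTimelike L X (variationField σ t s)) {t s : ℝ} (ht : t ∈ Ioo (0 : ℝ) 1)
    (hs : s ∈ Ioo (-ε) ε) :
    ∃ (f' : ℝ → ℝ) (f'' : ℝ),
      (∀ᶠ r in nhds t, HasDerivAt (fun r => F L (variationField σ r s)) (f' r) r) ∧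
      HasDerivAt f' f'' t ∧ f'' ≤ 0 := by
  set φ := chartAt (Coord n) (σ t s)
  have hφ : φ ∈ smoothCharts (n := n) M := IsManifold.chart_mem_maximalAtlas _
  have hp : (t, s) ∈ chartDomain φ ε σ := ⟨⟨ht, hs⟩, mem_chart_source _ _⟩
  have hvt := hV t (Ioo_subset_Icc_self ht) s hs
  -- The nonzero reference vector for the connection coefficients is `V(t, s)` in the chart.
  have hv₀ := fderiv_chart_comp_ne_zero hB.toIsLorentzFinsler hφ hσ hp hvt.1
  have h := isCoordGeodesicVariation hB hφ hσ hgeo (fun t ht s hs => (hV t ht s hs).1) hv₀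
  obtain ⟨f', f'', h1, h2, h3⟩ := h.sqrt_second_nonpos (hB.isCoordBerwald hφ) hv₀ hp
    (by rw [← L_variationField (L := L) hφ hσ hp]; exact hvt.1)
    (gForm_curvOp_nonpos hB hK (v := variationVector σ t s) hvt
      (mfderiv_chart_variationVector hφ hσ hp) _)
  refine ⟨f', f'', ?_, h2, h3⟩
  -- The chart formula for `F(V)` must hold near every `r` close to `t`, since derivatives at such
  -- `r` are transferred.
  have hO : ∀ᶠ r in nhds t, (r, s) ∈ chartDomain φ ε σ :=
    (Continuous.continuousAt (by fun_prop : Continuous fun r : ℝ => (r, s))).eventually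
      ((isOpen_chartDomain hσ).mem_nhds hp)
  filter_upwards [h1, hO.eventually_nhds] with r hr hr2
  refine hr.congr_of_eventuallyEq ?_
  filter_upwards [hr2] with r' hr'
  rw [F, L_variationField (L := L) hφ hσ hr']

end Variation

end FinslerSpacetime

end

/-! ### Concavity on the closed interval -/

theorem proposition3p3 (n : ℕ) (hn : 2 ≤ n)
    (M : Type*) [TopologicalSpace M] [ChartedSpace (FinslerSpacetime.Coord n) M]
    [IsManifold 𝓘(ℝ, FinslerSpacetime.Coord n) ∞ M]
    [T2Space M] [SecondCountableTopology M] [ConnectedSpace M]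
    (L : TangentBundle 𝓘(ℝ, FinslerSpacetime.Coord n) M → ℝ)
    (X : ∀ x : M, TangentSpace 𝓘(ℝ, FinslerSpacetime.Coord n) x)
    (hB : FinslerSpacetime.IsBerwaldSpacetime L X)
    (hK : FinslerSpacetime.NonnegTimelikeFlagCurvature L X)
    (U : Set M) (hU : FinslerSpacetime.IsConvexNormalNhd L U)
    (ε : ℝ) (hε : 0 < ε) (σ : ℝ → ℝ → M)
    (hσ : ContMDiffOn 𝓘(ℝ, ℝ × ℝ) 𝓘(ℝ, FinslerSpacetime.Coord n) 2
      (fun p : ℝ × ℝ => σ p.1 p.2) (Icc 0 1 ×ˢ Ioo (-ε) ε))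
    (hσU : ∀ t ∈ Icc (0 : ℝ) 1, ∀ s ∈ Ioo (-ε) ε, σ t s ∈ U)
    (hgeo : ∀ s ∈ Ioo (-ε) ε, FinslerSpacetime.IsGeodesic L (fun t => σ t s))
    (hV : ∀ t ∈ Icc (0 : ℝ) 1, ∀ s ∈ Ioo (-ε) ε,
      FinslerSpacetime.IsFutureTimelike L X (FinslerSpacetime.variationField σ t s)) :
    ∀ s ∈ Ioo (-ε) ε, ConcaveOn ℝ (Icc (0 : ℝ) 1)
      (fun t => FinslerSpacetime.F L (FinslerSpacetime.variationField σ t s)) := by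
  intro s hs
  have key := fun t (ht : t ∈ Ioo (0 : ℝ) 1) =>
    FinslerSpacetime.F_variationField_second_nonpos hB hK hσ hgeo hV ht hs
  have hderiv : ∀ t ∈ Ioo (0 : ℝ) 1, ∃ f'' : ℝ, HasDerivAt
      (deriv fun t => FinslerSpacetime.F L (FinslerSpacetime.variationField σ t s)) f'' t ∧
      f'' ≤ 0 := by
    intro t ht
    obtain ⟨f', f'', h1, h2, h3⟩ := key t ht
    exact ⟨f'', h2.congr_of_eventuallyEq (h1.mono fun r hr => hr.deriv), h3⟩
  -- The criterion needs derivatives only in the interior; at the endpoints continuity suffices.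
  refine concaveOn_of_deriv2_nonpos (convex_Icc 0 1)
    (FinslerSpacetime.continuousOn_F_variationField hB.toIsLorentzFinsler hσ hs
      fun t ht => (hV t ht s hs).1) ?_ ?_ ?_
  · rw [interior_Icc]
    intro t ht
    obtain ⟨f', -, h1, -⟩ := key t ht
    exact h1.self_of_nhds.differentiableAt.differentiableWithinAt
  · rw [interior_Icc]
    intro t ht
    obtain ⟨f'', h1, -⟩ := hderiv t ht
    exact h1.differentiableAt.differentiableWithinAt
  · rw [interior_Icc]
    intro t ht
    obtain ⟨f'', h1, h2⟩ := hderiv t ht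
    rw [Function.iterate_succ, Function.iterate_one, Function.comp_apply, h1.deriv]
    exact h2
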